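/- Let $a_1,a_2\in\mathbb R^2$ be vectors of equal length enclosing the angle $\pi/3$. The infinite kagome lattice has the sites $ma_1+na_2$, $ma_1+na_2+\tfrac12a_1$, $ma_1+na_2+\tfrac12a_2$ ($m,n\in\mathbb Z$), and two sites are neighbours if their distance is $\tfrac12|a_1|$. Impose periodic boundary conditions: let $\Gamma\subset\mathbb Za_1+\mathbb Za_2$ be a subgroup of finite index that contains none of $a_1$, $a_2$, $a_1-a_2$ (so that every site keeps four distinct neighbours), let $\Lambda$ be the finite set of sites modulo $\Gamma$, and call two elements of $\Lambda$ neighbours if they have neighbouring representatives. Let $t>0$ and $U>0$, let $t_{x,y}=t$ if $x,y\in\Lambda$ are neighbours and $t_{x,y}=0$ otherwise, and consider the Hubbard Hamiltonian $$H=\sum_{x,y\in\Lambda}\sum_{\sigma=\uparrow,\downarrow}t_{x,y}\,c^\dagger_{x,\sigma}c_{y,\sigma}+U\sum_{x\in\Lambda}n_{x,\uparrow}n_{x,\downarrow},\qquad n_{x,\sigma}=c^\dagger_{x,\sigma}c_{x,\sigma},$$ on the fermionic Fock space of dimension $4^{|\Lambda|}$. Let $\hat S^{(\alpha)}_{\rm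 tot}=\frac12\sum_{x\in\Lambda}\sum_{\sigma,\tau}c^\dagger_{x,\sigma}(p^{(\alpha)})_{\sigma,\tau}c_{x,\tau}$ ($\alpha=1,2,3$, with the Pauli matrices $p^{(\alpha)}$) be the total spin operators and $(\hat{\mathbf S}_{\rm tot})^2=\sum_\alpha(\hat S^{(\alpha)}_{\rm tot})^2$. For $N$ electrons put $S_{\max}=N/2$ if $N\le|\Lambda|$ and $S_{\max}=|\Lambda|-N/2$ otherwise. Then $|\Lambda|$ is divisible by $3$, the lowest eigenvalue of the hopping matrix $(t_{x,y})$ is $-2t$, and its degeneracy is $M=|\Lambda|/3+1$. Fix the electron number to be $N_{\rm e}=M$; then $S_{\max}=M/2$. For every $U>0$ all the ground states of $H$ in the $N_{\rm e}$-electron space have total spin $S_{\rm tot}=S_{\max}=M/2$, i.e. satisfy $(\hat{\mathbf S}_{\rm tot})^2\Phi=S_{\max}(S_{\max}+1)\Phi$, and they are nondegenerate apart from the trivial spin degeneracy: the space of ground states has dimension $2S_{\max}+1=M+1$, and for each $m=-S_{\max},-S_{\max}+1,\dots,S_{\max}$ the ground state with $\hat S^{(3)}_{\rm tot}\Phi=m\Phi$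 is unique up to a constant factor. -/

import Mathlib

noncomputable section

namespace Hubbard

/-! ## Fock space

For a finite set `ι` of one-electron modes the fermionic Fock space is the Hilbert space with
orthonormal basis the occupation configurations `S : Finset ι`; a state is the family of its
amplitudes. The phases are the usual Jordan-Wigner signs, relative to a fixed enumeration of the
modes. -/

/-- The fermionic Fock space over the modes `ι`, of dimension `2 ^ |ι|`. -/
abbrev Fock (ι : Type*) [Fintype ι] : Type _ := EuclideanSpace ℂ (Finset ι)

/-- The sign `(-1) ^ #{j ∈ S : j comes before i}`. -/
def jwSign {ι : Type*} [Fintype ι] (i : ι) (S : Finset ι) : ℂ :=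
  (-1) ^ (S.filter fun j => Fintype.equivFin ι j < Fintype.equivFin ι i).card

open scoped Classical in
/-- The annihilation operator `c_i`: it maps the basis state `S ∪ {i}`, `i ∉ S`, to `±S`, and
kills the basis states in which `i` is empty. -/
def annihilate {ι : Type*} [Fintype ι] (i : ι) : Fock ι →ₗ[ℂ] Fock ι where
  toFun Φ := WithLp.toLp 2 fun S => if i ∈ S then 0 else jwSign i S * Φ (insert i S)
  map_add' Φ Ψ := by
    ext S
    by_cases h : i ∈ S <;> simp [h, mul_add]
  map_smul' a Φ := by
    ext S
    by_cases h : i ∈ S <;> simp [h, mul_left_comm]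

/-- The creation operator `c_i†`. -/
def create {ι : Type*} [Fintype ι] (i : ι) : Fock ι →ₗ[ℂ] Fock ι :=
  LinearMap.adjoint (annihilate i)

/-- The number operator `n_i = c_i† c_i`. -/
def number {ι : Type*} [Fintype ι] (i : ι) : Fock ι →ₗ[ℂ] Fock ι :=
  create i * annihilate i

/-! ## The Hubbard model on a finite lattice

The modes are the pairs (site, spin), where the spin is `0` for up and `1` for down. -/

/-- The Hilbert space of electrons with spin on the lattice `Λ`, of dimension `4 ^ |Λ|`. -/
abbrev State (Λ : Type*) [Fintype Λ] : Type _ := Fock (Λ × Fin 2)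

/-- `H_hop = ∑_{x,y} ∑_σ t_{x,y} c†_{x,σ} c_{y,σ}`. -/
def hopping {Λ : Type*} [Fintype Λ] (t : Matrix Λ Λ ℝ) : State Λ →ₗ[ℂ] State Λ :=
  ∑ x : Λ, ∑ y : Λ, ∑ σ : Fin 2, (t x y : ℂ) • (create (x, σ) * annihilate (y, σ))

/-- `H_int = ∑_x U_x n_{x,↑} n_{x,↓}`. -/
def interaction {Λ : Type*} [Fintype Λ] (U : Λ → ℝ) : State Λ →ₗ[ℂ] State Λ :=
  ∑ x : Λ, (U x : ℂ) • (number (x, 0) * number (x, 1))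

/-- The Hubbard Hamiltonian `H = H_hop + H_int`. -/
def hamiltonian {Λ : Type*} [Fintype Λ] (t : Matrix Λ Λ ℝ) (U : Λ → ℝ) :
    State Λ →ₗ[ℂ] State Λ :=
  hopping t + interaction U

/-- The total electron number `N̂_e`. -/
def totalNumber (Λ : Type*) [Fintype Λ] : State Λ →ₗ[ℂ] State Λ :=
  ∑ x : Λ, (number (x, 0) + number (x, 1))

/-- The Pauli matrices. -/
def pauli : Fin 3 → Matrix (Fin 2) (Fin 2) ℂ :=
  ![!![0, 1; 1, 0], !![0, -Complex.I; Complex.I, 0], !![1, 0; 0, -1]]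

/-- The spin operator at the site `x`,
`S_x^(α) = (1/2) ∑_{σ,τ} c†_{x,σ} (p^(α))_{σ,τ} c_{x,τ}`. -/
def siteSpin {Λ : Type*} [Fintype Λ] (α : Fin 3) (x : Λ) : State Λ →ₗ[ℂ] State Λ :=
  (1 / 2 : ℂ) • ∑ σ : Fin 2, ∑ τ : Fin 2,
    pauli α σ τ • (create (x, σ) * annihilate (x, τ))

/-- The components of the total spin. The third component is `totalSpin Λ 2`. -/
def totalSpin (Λ : Type*) [Fintype Λ] (α : Fin 3) : State Λ →ₗ[ℂ] State Λ :=
  ∑ x : Λ, siteSpin α x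

/-- The squared total spin `(S_tot)²`. -/
def totalSpinSq (Λ : Type*) [Fintype Λ] : State Λ →ₗ[ℂ] State Λ :=
  ∑ α : Fin 3, totalSpin Λ α ^ 2

/-- The maximal total spin of `N` electrons on `n` sites. -/
def maxSpin (n N : ℕ) : ℝ := if N ≤ n then (N : ℝ) / 2 else (n : ℝ) - (N : ℝ) / 2

/-- The states with exactly `N` electrons. -/
def sector (Λ : Type*) [Fintype Λ] (N : ℕ) : Submodule ℂ (State Λ) :=
  Module.End.eigenspace (totalNumber Λ) (N : ℂ)

/-- The states with exactly `N` electrons that are eigenstates of `H` with energy `E`,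
together with `0`. -/
def energySpace {Λ : Type*} [Fintype Λ] (H : State Λ →ₗ[ℂ] State Λ) (N : ℕ) (E : ℝ) :
    Submodule ℂ (State Λ) :=
  sector Λ N ⊓ Module.End.eigenspace H (E : ℂ)

/-- `E` is the ground state energy of `H` among the states with exactly `N` electrons. The
ground states are then the nonzero elements of `energySpace H N E`. -/
def IsGroundEnergy {Λ : Type*} [Fintype Λ] (H : State Λ →ₗ[ℂ] State Λ) (N : ℕ) (E : ℝ) :
    Prop :=
  IsLeast {E' : ℝ | energySpace H N E' ≠ ⊥} E

/-! ## The kagome lattice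

Let `a₁, a₂` be primitive translations of the triangular Bravais lattice, of equal length and at
the angle `π/3`. The sites of the infinite kagome lattice are the points
`m a₁ + n a₂`, `m a₁ + n a₂ + a₁/2`, `m a₁ + n a₂ + a₂/2`, encoded as `((m, n), k)`, `k = 0, 1, 2`.
Periodic boundary conditions identify the points that differ by a translation in a subgroup `Γ`
of finite index. -/

/-- The sites of the kagome lattice with periods `Γ`. -/
abbrev KagomeSite (Γ : AddSubgroup (ℤ × ℤ)) : Type := ((ℤ × ℤ) ⧸ Γ) × Fin 3

instance (Γ : AddSubgroup (ℤ × ℤ)) [Γ.FiniteIndex] : Fintype ((ℤ × ℤ) ⧸ Γ) :=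
  AddSubgroup.fintypeQuotientOfFiniteIndex

/-- The site `(c, k)` is a corner of the downward triangle with label `c + kagomeShift k`. -/
def kagomeShift : Fin 3 → ℤ × ℤ := ![(0, 0), (1, 0), (0, 1)]

/-- The cell of a site: the sites `(c, 0), (c, 1), (c, 2)` of a cell are the corners of an
upward triangle. -/
def upTriangle {Γ : AddSubgroup (ℤ × ℤ)} (x : KagomeSite Γ) : (ℤ × ℤ) ⧸ Γ := x.1

/-- The downward triangle of a site, labelled by its corner of type `0`: the sites `(d, 0), (d - a₁, 1), (d - a₂, 2)` are the corners
of the downward triangle with label `d`. -/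
def downTriangle {Γ : AddSubgroup (ℤ × ℤ)} (x : KagomeSite Γ) : (ℤ × ℤ) ⧸ Γ :=
  x.1 + QuotientAddGroup.mk (kagomeShift x.2)

/-- Two sites are neighbours if they are different corners of a common triangle. -/
def kagomeGraph (Γ : AddSubgroup (ℤ × ℤ)) : SimpleGraph (KagomeSite Γ) where
  Adj x y := x ≠ y ∧ (upTriangle x = upTriangle y ∨ downTriangle x = downTriangle y)
  symm := ⟨fun _ _ h => ⟨h.1.symm, h.2.imp Eq.symm Eq.symm⟩⟩
  loopless := ⟨fun _ h => h.1 rfl⟩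

open scoped Classical in
/-- The hopping amplitudes: `t` between neighbours and `0` otherwise. -/
def kagomeHopping (Γ : AddSubgroup (ℤ × ℤ)) (t : ℝ) : Matrix (KagomeSite Γ) (KagomeSite Γ) ℝ :=
  fun x y => if (kagomeGraph Γ).Adj x y then t else 0

end Hubbard

end

/-! Let `B` be the incidence matrix between triangles and sites. Every site lies on one upward and
one downward triangle, and distinct sites share at most one triangle, so the hopping matrix is `t
(BᵀB - 2)`. Hence its lowest level is `-2t`, with eigenspace `ker B`. With `n` cells there are `2n`
triangles and `3n` sites; `ker Bᵀ` is spanned by `+1` on upward and `-1` on downward triangles, so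
`dim ker B = 3n - (2n - 1) = n + 1 = M`.

On `N` electrons, `H + 2tN` is a positive combination of squares `b†b`, where `b` runs over the
field operators of the rows of `B` and over the pairs `c_{x,↑} c_{x,↓}`. Its zero-energy states are
therefore those killed by all these operators (`energySpace_eq`). Filling `ker B` with up spins
gives such a state; lowering its spin gives `M + 1` of them, all of total spin `M/2` and with
distinct third components.

It remains to bound the dimension by `M + 1` (`finrank_sector_inf_flatSpace_le`). Choose a basis
`f_i` of `ker B` dual to evaluation at sites `z_i`. Modulo the rows of `B`, the unit vector at `x`
is `∑ f_i(x) δ_{z_i}`, so on zero-energy states `c_{x,σ} = ∑ f_i(x) c_{z_i,σ}`, and a state is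
determined by its amplitudes at the `z_i`. Double occupancy being excluded, each of the `M` sites
`z_i` carries one spin. If `f_i` and `f_j` overlap at `x`, the absence of double occupancy at `x`
forces symmetry under exchange of the spins at `z_i` and `z_j` (`spinAmplitude_comp_swap`). When the
overlaps connect all indices, only the number of up spins matters.

Connectivity follows once only constants multiply `ker B` into itself (`rel_of_mul_mem_ker`). For
kagome this is seen on the alternating hexagon states: each triangle that meets a hexagon does so in
two sites, where the multiplier must agree. -/

namespace Hubbard

/-! ### Anticommutation relations and second quantization. -/

section CAR

variable {ι : Type*} [Fintype ι]

open scoped Classical in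
theorem annihilate_apply (i : ι) (Φ : Fock ι) (S : Finset ι) :
    annihilate i Φ S = if i ∈ S then 0 else jwSign i S * Φ (insert i S) := rfl

theorem jwSign_mul_self (i : ι) (S : Finset ι) : jwSign i S * jwSign i S = 1 := by
  rw [jwSign, ← pow_add, ← two_mul, pow_mul]; simp

theorem conj_jwSign (i : ι) (S : Finset ι) : starRingEnd ℂ (jwSign i S) = jwSign i S := by
  simp [jwSign]

open scoped Classical in
theorem jwSign_insert (i j : ι) (S : Finset ι) (hj : j ∉ S) :
    jwSign i (insert j S) =
      (if Fintype.equivFin ι j < Fintype.equivFin ι i then -1 else 1) * jwSign i S := by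
  unfold jwSign
  rw [Finset.filter_insert]
  split_ifs with h
  · rw [Finset.card_insert_of_notMem (by simp [hj]), pow_succ]; ring
  · simp

-- Exactly one of the two modes precedes the other in the enumeration, so exactly one of the two
-- insertions flips a sign.
open scoped Classical in
theorem jwSign_mul_jwSign_insert {i j : ι} (hij : i ≠ j) (S : Finset ι) (hi : i ∉ S)
    (hj : j ∉ S) :
    jwSign i S * jwSign j (insert i S) = -(jwSign j S * jwSign i (insert j S)) := by
  rw [jwSign_insert _ _ _ hi, jwSign_insert _ _ _ hj]
  have hne : Fintype.equivFin ι i ≠ Fintype.equivFin ι j := fun h => hij (by simpa using h)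
  rcases lt_or_gt_of_ne hne with h | h
  · rw [if_pos h, if_neg h.le.not_gt]; ring
  · rw [if_neg h.le.not_gt, if_pos h]; ring

open scoped Classical in
theorem annihilate_single (i : ι) (S : Finset ι) :
    annihilate i (EuclideanSpace.single S (1 : ℂ)) =
      if i ∈ S then jwSign i (S.erase i) • EuclideanSpace.single (S.erase i) (1 : ℂ) else 0 := by
  ext R
  rw [annihilate_apply]
  by_cases hS : i ∈ S
  · by_cases hR : i ∈ R
    · have : R ≠ S.erase i := by rintro rfl; simp at hR
      simp [hS, hR, this]
    · by_cases h : R = S.erase i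
      · subst h; simp [hS, Finset.insert_erase hS]
      · have : insert i R ≠ S := by
          rintro rfl; exact h (by rw [Finset.erase_insert hR])
        simp [hS, hR, h, this]
  · have : insert i R ≠ S := by rintro rfl; simp at hS
    simp [hS, this]

open scoped Classical in
theorem create_apply (i : ι) (Φ : Fock ι) (S : Finset ι) :
    create i Φ S = if i ∈ S then jwSign i (S.erase i) * Φ (S.erase i) else 0 := by
  have h : inner ℂ (EuclideanSpace.single S (1 : ℂ)) (create i Φ) = create i Φ S := by
    simp [EuclideanSpace.inner_single_left]
  rw [← h, create, LinearMap.adjoint_inner_right, annihilate_single]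
  split_ifs
  · rw [inner_smul_left, EuclideanSpace.inner_single_left, conj_jwSign]; simp
  · simp

theorem annihilate_mul_annihilate (i j : ι) :
    annihilate i * annihilate j = -(annihilate j * annihilate i) := by
  classical
  ext Φ S
  simp only [Module.End.mul_apply, LinearMap.neg_apply, PiLp.neg_apply, annihilate_apply,
    Finset.mem_insert]
  by_cases hij : i = j
  · subst hij; simp
  · by_cases hi : i ∈ S
    · simp [hi]
    · by_cases hj : j ∈ S
      · simp [hi, hj]
      · simp only [hi, hj, hij, Ne.symm hij, if_false, or_self]
        rw [← mul_assoc, ← mul_assoc, jwSign_mul_jwSign_insert hij S hi hj,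
          Finset.insert_comm]
        ring

theorem annihilate_mul_self (i : ι) : annihilate i * annihilate i = 0 := by
  classical
  ext Φ S
  simp [annihilate_apply]

theorem create_mul_create (i j : ι) : create i * create j = -(create j * create i) := by
  have h := congrArg LinearMap.adjoint (annihilate_mul_annihilate j i)
  rw [map_neg] at h
  simpa [create, Module.End.mul_eq_comp, LinearMap.adjoint_comp] using h

open scoped Classical in
theorem annihilate_mul_create (i j : ι) :
    annihilate i * create j = (if i = j then 1 else 0) - create j * annihilate i := by
  rw [eq_sub_iff_add_eq]
  ext Φ S
  simp only [Module.End.mul_apply, LinearMap.add_apply, PiLp.add_apply, annihilate_apply,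
    create_apply]
  by_cases hij : i = j
  · subst hij
    by_cases hi : i ∈ S
    · simp only [hi, if_true, Finset.notMem_erase, if_false, Finset.insert_erase hi]
      rw [← mul_assoc, jwSign_mul_self]; simp
    · simp only [hi, if_false, Finset.mem_insert_self, if_true, Finset.erase_insert hi]
      rw [← mul_assoc, jwSign_mul_self]; simp
  · by_cases hi : i ∈ S
    · by_cases hj : j ∈ S <;> simp [hi, hj, hij]
    · by_cases hj : j ∈ S
      · obtain ⟨R, hR, rfl⟩ : ∃ R, j ∉ R ∧ S = insert j R :=
          ⟨S.erase j, by simp, by rw [Finset.insert_erase hj]⟩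
        have hiR : i ∉ R := fun h => hi (by simp [h])
        have e1 : (insert i (insert j R)).erase j = insert i R := by
          rw [Finset.insert_comm, Finset.erase_insert (by simp [hR, Ne.symm hij])]
        have e3 := jwSign_insert i j R hR
        have e4 := jwSign_insert j i R hiR
        have e5 := jwSign_mul_jwSign_insert hij R hiR hR
        have a1 := jwSign_mul_self i R
        have a2 := jwSign_mul_self j R
        -- This is `e5` multiplied by two of its signs, all of which square to 1.
        have e6 : jwSign i (insert j R) * jwSign j (insert i R) = -(jwSign j R * jwSign i R) := by
          linear_combination jwSign i (insert j R) * jwSign i R * e5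
            - jwSign i (insert j R) * jwSign j (insert i R) * a1
            - jwSign j R * jwSign i R * jwSign_mul_self i (insert j R)
        simp only [hi, hij, if_false, Finset.mem_insert_self, if_true, Finset.erase_insert hR, e1,
          Finset.mem_insert, or_true, hiR]
        rw [← mul_assoc, ← mul_assoc, e6]; simp
      · simp [hi, hj, hij, Ne.symm hij]

/-- The second quantization `∑_{i,j} A_{i,j} c†_i c_j` of a one-electron operator. -/
noncomputable def secondQuant (A : Matrix ι ι ℂ) : Fock ι →ₗ[ℂ] Fock ι :=
  ∑ i, ∑ j, A i j • (create i * annihilate j)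

theorem secondQuant_add (A B : Matrix ι ι ℂ) :
    secondQuant (A + B) = secondQuant A + secondQuant B := by
  simp [secondQuant, add_smul, Finset.sum_add_distrib]

theorem secondQuant_smul (a : ℂ) (A : Matrix ι ι ℂ) :
    secondQuant (a • A) = a • secondQuant A := by
  simp [secondQuant, Finset.smul_sum, mul_smul]

theorem secondQuant_sub (A B : Matrix ι ι ℂ) :
    secondQuant (A - B) = secondQuant A - secondQuant B := by
  simp [secondQuant, sub_smul]

theorem annihilate_mul_secondQuant (k : ι) (A : Matrix ι ι ℂ) :
    annihilate k * secondQuant A = secondQuant A * annihilate k + ∑ j, A k j • annihilate j := by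
  classical
  have key : ∀ i j, annihilate k * (create i * annihilate j) =
      create i * annihilate j * annihilate k + (if k = i then annihilate j else 0) := by
    intro i j
    rw [← mul_assoc, annihilate_mul_create, sub_mul, mul_assoc, annihilate_mul_annihilate k j]
    split_ifs <;> simp [mul_assoc, add_comm]
  simp only [secondQuant, Finset.mul_sum, Finset.sum_mul, mul_smul_comm, smul_mul_assoc, key,
    smul_add, Finset.sum_add_distrib]
  congr 1
  rw [Finset.sum_comm]
  simp

theorem create_mul_secondQuant (k : ι) (A : Matrix ι ι ℂ) :
    create k * secondQuant A = secondQuant A * create k - ∑ i, A i k • create i := by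
  classical
  have key : ∀ i j, create k * (create i * annihilate j) =
      create i * annihilate j * create k - (if j = k then create i else 0) := by
    intro i j
    rw [← mul_assoc, create_mul_create k i, mul_assoc, annihilate_mul_create, mul_sub]
    split_ifs <;> simp [mul_assoc]
  simp only [secondQuant, Finset.mul_sum, Finset.sum_mul, mul_smul_comm, smul_mul_assoc, key,
    smul_sub, Finset.sum_sub_distrib]
  congr 1
  simp

/-- Moving `c†_i c_j` past `secondQuant B` produces one commutator term from each factor. All spin
and number relations below reduce to identities between matrices through this. -/
theorem secondQuant_mul_sub (A B : Matrix ι ι ℂ) :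
    secondQuant A * secondQuant B - secondQuant B * secondQuant A =
      secondQuant (A * B - B * A) := by
  have key : ∀ i j, create i * annihilate j * secondQuant B =
      secondQuant B * (create i * annihilate j)
        + (∑ k, B j k • (create i * annihilate k) - ∑ k, B k i • (create k * annihilate j)) := by
    intro i j
    rw [mul_assoc, annihilate_mul_secondQuant, mul_add, ← mul_assoc, create_mul_secondQuant,
      sub_mul, mul_assoc, Finset.mul_sum, Finset.sum_mul]
    simp only [mul_smul_comm, smul_mul_assoc]
    abel
  rw [secondQuant_sub, sub_eq_iff_eq_add]
  conv_lhs => rw [secondQuant]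
  simp only [Finset.sum_mul, smul_mul_assoc, key, smul_add, smul_sub, Finset.sum_add_distrib,
    Finset.sum_sub_distrib]
  rw [add_comm]
  congr 1
  · congr 1
    · simp only [secondQuant, Matrix.mul_apply, Finset.sum_smul, Finset.smul_sum, mul_smul]
      exact Finset.sum_congr rfl fun i _ => Finset.sum_comm
    · simp only [secondQuant, Matrix.mul_apply, Finset.sum_smul, Finset.smul_sum, smul_smul]
      rw [Finset.sum_comm]
      rw [Finset.sum_congr rfl fun i _ => Finset.sum_comm]
      rw [Finset.sum_comm]
      refine Finset.sum_congr rfl fun i _ => Finset.sum_congr rfl fun j _ =>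
        Finset.sum_congr rfl fun k _ => ?_
      rw [mul_comm]
  · conv_rhs =>
      rw [show secondQuant A = ∑ i, ∑ j, A i j • (create i * annihilate j) from rfl]
    simp only [Finset.mul_sum, mul_smul_comm]

end CAR
-- Number operators are diagonal in the occupation basis.
section NumberOperator

variable {ι : Type*} [Fintype ι]

open scoped Classical in
theorem number_apply (i : ι) (Φ : Fock ι) (S : Finset ι) :
    number i Φ S = if i ∈ S then Φ S else 0 := by
  rw [number, Module.End.mul_apply, create_apply]
  split_ifs with h
  · rw [annihilate_apply, if_neg (by simp), ← mul_assoc, jwSign_mul_self, one_mul,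
      Finset.insert_erase h]
  · rfl

theorem secondQuant_one [DecidableEq ι] : secondQuant (1 : Matrix ι ι ℂ) = ∑ i, number i := by
  simp [secondQuant, number, Matrix.one_apply, ite_smul]

theorem sum_number_apply (Φ : Fock ι) (S : Finset ι) :
    (∑ i, number i) Φ S = (S.card : ℂ) * Φ S := by
  classical
  simp [LinearMap.sum_apply, number_apply]

end NumberOperator

/-! ### Electron-number sectors. -/

section Sectors

variable {Λ : Type*} [Fintype Λ]

theorem totalNumber_eq_sum : totalNumber Λ = ∑ i : Λ × Fin 2, number i := by
  rw [Fintype.sum_prod_type]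
  simp [totalNumber]

theorem totalNumber_eq_secondQuant [DecidableEq Λ] : totalNumber Λ = secondQuant 1 := by
  rw [totalNumber_eq_sum, secondQuant_one]

theorem mem_sector_iff (N : ℕ) (Φ : State Λ) :
    Φ ∈ sector Λ N ↔ totalNumber Λ Φ = (N : ℂ) • Φ := Module.End.mem_eigenspace_iff

theorem annihilate_mem_sector {N : ℕ} {Φ : State Λ} (h : Φ ∈ sector Λ (N + 1)) (i : Λ × Fin 2) :
    annihilate i Φ ∈ sector Λ N := by
  classical
  rw [mem_sector_iff] at h ⊢
  have := congrArg (fun f => f Φ) (annihilate_mul_secondQuant i (1 : Matrix (Λ × Fin 2) _ ℂ))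
  simp only [Matrix.one_apply, ite_smul, one_smul, zero_smul, Finset.sum_ite_eq,
    Finset.mem_univ, if_true, LinearMap.add_apply, Module.End.mul_apply,
    ← totalNumber_eq_secondQuant, h] at this
  rw [← sub_eq_iff_eq_add] at this
  rw [← this, map_smul]
  push_cast
  module

theorem create_mem_sector {N : ℕ} {Φ : State Λ} (h : Φ ∈ sector Λ N) (i : Λ × Fin 2) :
    create i Φ ∈ sector Λ (N + 1) := by
  classical
  rw [mem_sector_iff] at h ⊢
  have := congrArg (fun f => f Φ) (create_mul_secondQuant i (1 : Matrix (Λ × Fin 2) _ ℂ))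
  simp only [Matrix.one_apply, ite_smul, one_smul, zero_smul, Finset.sum_ite_eq',
    Finset.mem_univ, if_true, LinearMap.sub_apply, Module.End.mul_apply,
    ← totalNumber_eq_secondQuant, h] at this
  rw [eq_sub_iff_add_eq] at this
  rw [← this, map_smul]
  push_cast
  module

theorem secondQuant_mem_sector {N : ℕ} {Φ : State Λ} (h : Φ ∈ sector Λ N)
    (A : Matrix (Λ × Fin 2) (Λ × Fin 2) ℂ) : secondQuant A Φ ∈ sector Λ N := by
  classical
  rw [mem_sector_iff] at h ⊢
  have := congrArg (fun f => f Φ) (secondQuant_mul_sub 1 A)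
  simp only [one_mul, mul_one, LinearMap.sub_apply, Module.End.mul_apply, sub_self,
    ← totalNumber_eq_secondQuant, h] at this
  rw [sub_eq_iff_eq_add] at this
  rw [this, map_smul]
  simp [secondQuant]

theorem eq_zero_of_mem_sector_zero {Φ : State Λ} (h : Φ ∈ sector Λ 0) (h0 : Φ ∅ = 0) :
    Φ = 0 := by
  ext S
  rcases S.eq_empty_or_nonempty with rfl | hS
  · simpa using h0
  · rw [mem_sector_iff, totalNumber_eq_sum] at h
    have := congrArg (fun Ψ : State Λ => Ψ S) h
    simp only [sum_number_apply] at this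
    simpa [hS.ne_empty] using this

/-- `(N + 1) Φ = ∑ c†_i c_i Φ`. This drives the induction on the electron number. -/
theorem eq_zero_of_forall_annihilate {N : ℕ} {Φ : State Λ} (h : Φ ∈ sector Λ (N + 1))
    (h0 : ∀ i, annihilate i Φ = 0) : Φ = 0 := by
  rw [mem_sector_iff, totalNumber_eq_sum] at h
  have : ((N : ℂ) + 1) • Φ = 0 := by
    rw [← Nat.cast_succ, ← h]
    simp [LinearMap.sum_apply, number, h0]
  exact (smul_eq_zero.mp this).resolve_left (Nat.cast_add_one_ne_zero N)

end Sectors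

/-! ### Spin operators and their commutation relations. -/

section OneBody

variable {Λ : Type*} [Fintype Λ]

open scoped Kronecker

open scoped Classical in
/-- The operator `∑_x ∑_{σ,τ} p_{σ,τ} c†_{x,σ} c_{x,τ}` for a `2 × 2` matrix `p`. -/
noncomputable def spinOp (Λ : Type*) [Fintype Λ] (p : Matrix (Fin 2) (Fin 2) ℂ) :
    State Λ →ₗ[ℂ] State Λ :=
  secondQuant ((1 : Matrix Λ Λ ℂ) ⊗ₖ p)

theorem spinOp_smul (a : ℂ) (p : Matrix (Fin 2) (Fin 2) ℂ) :
    spinOp Λ (a • p) = a • spinOp Λ p := by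
  rw [spinOp, spinOp, Matrix.kronecker_smul, secondQuant_smul]

theorem spinOp_add (p q : Matrix (Fin 2) (Fin 2) ℂ) :
    spinOp Λ (p + q) = spinOp Λ p + spinOp Λ q := by
  rw [spinOp, spinOp, spinOp, Matrix.kronecker_add, secondQuant_add]

theorem spinOp_mul_sub (p q : Matrix (Fin 2) (Fin 2) ℂ) :
    spinOp Λ p * spinOp Λ q - spinOp Λ q * spinOp Λ p = spinOp Λ (p * q - q * p) := by
  classical
  rw [spinOp, spinOp, spinOp, secondQuant_mul_sub, ← Matrix.mul_kronecker_mul,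
    ← Matrix.mul_kronecker_mul, Matrix.mul_one]
  congr 1
  ext ⟨x, σ⟩ ⟨y, τ⟩
  simp [mul_sub]

theorem spinOp_eq_sum (p : Matrix (Fin 2) (Fin 2) ℂ) :
    spinOp Λ p = ∑ x : Λ, ∑ σ, ∑ τ, p σ τ • (create (x, σ) * annihilate (x, τ)) := by
  classical
  simp only [spinOp, secondQuant, Fintype.sum_prod_type, Matrix.kroneckerMap_apply,
    Matrix.one_apply, ite_mul, one_mul, zero_mul, ite_smul, zero_smul]
  refine Finset.sum_congr rfl fun x _ => Finset.sum_congr rfl fun σ _ => ?_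
  rw [Finset.sum_comm]
  simp

theorem annihilate_mul_spinOp (x : Λ) (σ : Fin 2) (p : Matrix (Fin 2) (Fin 2) ℂ) :
    annihilate (x, σ) * spinOp Λ p =
      spinOp Λ p * annihilate (x, σ) + ∑ τ, p σ τ • annihilate (x, τ) := by
  classical
  rw [spinOp, annihilate_mul_secondQuant]
  congr 1
  simp only [Fintype.sum_prod_type, Matrix.kroneckerMap_apply, Matrix.one_apply, ite_mul,
    one_mul, zero_mul, ite_smul, zero_smul]
  rw [Finset.sum_comm]
  simp

theorem totalSpin_eq_spinOp (α : Fin 3) :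
    totalSpin Λ α = (1 / 2 : ℂ) • spinOp Λ (pauli α) := by
  rw [spinOp_eq_sum, totalSpin, Finset.smul_sum]
  rfl

/-- The spin raising operator. -/
noncomputable def spinRaise (Λ : Type*) [Fintype Λ] : State Λ →ₗ[ℂ] State Λ :=
  spinOp Λ !![0, 1; 0, 0]

/-- The spin lowering operator. -/
noncomputable def spinLower (Λ : Type*) [Fintype Λ] : State Λ →ₗ[ℂ] State Λ :=
  spinOp Λ !![0, 0; 1, 0]

theorem spinRaise_mul_spinLower :
    spinRaise Λ * spinLower Λ = spinLower Λ * spinRaise Λ + (2 : ℂ) • totalSpin Λ 2 := by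
  rw [← sub_eq_iff_eq_add', spinRaise, spinLower, spinOp_mul_sub, totalSpin_eq_spinOp, smul_smul,
    mul_one_div_cancel two_ne_zero, one_smul]
  congr 1
  ext i j; fin_cases i <;> fin_cases j <;> simp [pauli]

theorem totalSpin_two_mul_spinLower :
    totalSpin Λ 2 * spinLower Λ = spinLower Λ * totalSpin Λ 2 - spinLower Λ := by
  have h : spinOp Λ (pauli 2) * spinLower Λ - spinLower Λ * spinOp Λ (pauli 2) =
      (-2 : ℂ) • spinLower Λ := by
    rw [spinLower, spinOp_mul_sub, ← spinOp_smul]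
    congr 1
    ext i j; fin_cases i <;> fin_cases j <;> simp [pauli]; norm_num
  rw [sub_eq_iff_eq_add] at h
  rw [totalSpin_eq_spinOp, smul_mul_assoc, h, mul_smul_comm]
  module

theorem totalSpinSq_eq :
    totalSpinSq Λ = totalSpin Λ 2 ^ 2 + totalSpin Λ 2 + spinLower Λ * spinRaise Λ := by
  have hx : totalSpin Λ 0 = (1 / 2 : ℂ) • (spinRaise Λ + spinLower Λ) := by
    rw [totalSpin_eq_spinOp, spinRaise, spinLower, ← spinOp_add]
    congr 2
    ext i j; fin_cases i <;> fin_cases j <;> simp [pauli]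
  have hy : totalSpin Λ 1 = (-Complex.I / 2 : ℂ) • (spinRaise Λ + (-1 : ℂ) • spinLower Λ) := by
    rw [totalSpin_eq_spinOp, spinRaise, spinLower, ← spinOp_smul, ← spinOp_smul, ← spinOp_add,
      ← spinOp_smul]
    congr 1
    ext i j; fin_cases i <;> fin_cases j <;> simp [pauli] <;> ring
  have hI : (-Complex.I / 2) ^ 2 = -(1 / 4) := by
    linear_combination (1 / 4 : ℂ) * Complex.I_mul_I
  rw [neg_one_smul, ← sub_eq_add_neg] at hy
  rw [totalSpinSq, Fin.sum_univ_three, hx, hy, smul_pow, smul_pow, hI, pow_two (_ + _), pow_two (_ - _)]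
  simp only [mul_add, add_mul, mul_sub, sub_mul, spinRaise_mul_spinLower]
  module

end OneBody

/-! ### Creation and annihilation of general one-electron states. -/

section Field

variable {Λ : Type*} [Fintype Λ]

/-- The annihilation operator `∑_x g_x c_{x,σ}` of a one-electron state. -/
noncomputable def fieldAnnihilate (g : Λ → ℝ) (σ : Fin 2) : State Λ →ₗ[ℂ] State Λ :=
  ∑ x, (g x : ℂ) • annihilate (x, σ)

/-- The creation operator `∑_x f_x c†_{x,σ}` of a one-electron state. -/
noncomputable def fieldCreate (f : Λ → ℝ) (σ : Fin 2) : State Λ →ₗ[ℂ] State Λ :=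
  ∑ x, (f x : ℂ) • create (x, σ)

theorem adjoint_fieldAnnihilate (g : Λ → ℝ) (σ : Fin 2) :
    LinearMap.adjoint (fieldAnnihilate g σ) = fieldCreate g σ := by
  rw [fieldAnnihilate, map_sum]
  refine Finset.sum_congr rfl fun x _ => ?_
  rw [map_smulₛₗ, Complex.conj_ofReal, create]

theorem annihilate_mul_fieldAnnihilate (i : Λ × Fin 2) (g : Λ → ℝ) (σ : Fin 2) :
    annihilate i * fieldAnnihilate g σ = -(fieldAnnihilate g σ * annihilate i) := by
  simp only [fieldAnnihilate, Finset.mul_sum, Finset.sum_mul, mul_smul_comm, smul_mul_assoc]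
  rw [← Finset.sum_neg_distrib]
  exact Finset.sum_congr rfl fun x _ => by rw [annihilate_mul_annihilate, smul_neg]

theorem annihilate_mul_fieldCreate (x : Λ) (σ τ : Fin 2) (f : Λ → ℝ) :
    annihilate (x, σ) * fieldCreate f τ =
      (if σ = τ then (f x : ℂ) else 0) • 1 - fieldCreate f τ * annihilate (x, σ) := by
  classical
  simp only [fieldCreate, Finset.mul_sum, Finset.sum_mul, mul_smul_comm, smul_mul_assoc,
    annihilate_mul_create, smul_sub, Finset.sum_sub_distrib]
  congr 1
  by_cases h : σ = τ <;> simp [h, Prod.ext_iff]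

theorem fieldAnnihilate_mul_fieldCreate (g f : Λ → ℝ) (σ τ : Fin 2) :
    fieldAnnihilate g σ * fieldCreate f τ =
      (if σ = τ then ((g ⬝ᵥ f : ℝ) : ℂ) else 0) • 1
        - fieldCreate f τ * fieldAnnihilate g σ := by
  simp only [fieldAnnihilate, Finset.sum_mul, Finset.mul_sum, smul_mul_assoc, mul_smul_comm,
    annihilate_mul_fieldCreate, smul_sub, Finset.sum_sub_distrib]
  congr 1
  split_ifs
  · rw [dotProduct, Complex.ofReal_sum, Finset.sum_smul]
    exact Finset.sum_congr rfl fun x _ => by rw [smul_smul, Complex.ofReal_mul]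
  · simp

end Field

/-! ### The zero-energy space of a flat-band Hamiltonian. -/

section GroundSpace

variable {Λ τ : Type*} [Fintype Λ]

/-- The states that are killed by the annihilation operators of the rows of `B` and by
`c_{x,↑} c_{x,↓}` for all sites `x`. -/
noncomputable def flatSpace (B : Matrix τ Λ ℝ) : Submodule ℂ (State Λ) :=
  (⨅ (T : τ) (σ : Fin 2), LinearMap.ker (fieldAnnihilate (B T) σ)) ⊓
    ⨅ x : Λ, LinearMap.ker (annihilate (x, 0) * annihilate (x, 1))

theorem mem_flatSpace_iff (B : Matrix τ Λ ℝ) (Φ : State Λ) :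
    Φ ∈ flatSpace B ↔ (∀ T σ, fieldAnnihilate (B T) σ Φ = 0) ∧
      ∀ x : Λ, annihilate (x, 0) (annihilate (x, 1) Φ) = 0 := by
  simp [flatSpace, Submodule.mem_iInf]

theorem annihilate_mem_flatSpace {B : Matrix τ Λ ℝ} {Φ : State Λ} (h : Φ ∈ flatSpace B)
    (i : Λ × Fin 2) : annihilate i Φ ∈ flatSpace B := by
  rw [mem_flatSpace_iff] at h ⊢
  refine ⟨fun T σ => ?_, fun x => ?_⟩
  · have := congrArg (fun f => f Φ) (annihilate_mul_fieldAnnihilate i (B T) σ)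
    simp only [Module.End.mul_apply, h.1, map_zero, LinearMap.neg_apply] at this
    exact neg_eq_zero.mp this.symm
  · have e : annihilate (x, 0) * annihilate (x, 1) * annihilate i =
        annihilate i * (annihilate (x, 0) * annihilate (x, 1)) := by
      rw [mul_assoc, annihilate_mul_annihilate (x, 1) i, mul_neg, ← mul_assoc,
        annihilate_mul_annihilate (x, 0) i, neg_mul, neg_neg, mul_assoc]
    have := congrArg (fun f => f Φ) e
    simpa [h.2] using this

variable [Fintype τ]

theorem hopping_gram [DecidableEq Λ] (B : Matrix τ Λ ℝ) (t : ℝ) :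
    hopping (t • (B.transpose * B) - (2 * t) • (1 : Matrix Λ Λ ℝ)) =
      (t : ℂ) • ∑ T, ∑ σ, fieldCreate (B T) σ * fieldAnnihilate (B T) σ
        - (2 * t : ℂ) • totalNumber Λ := by
  have h1 : ∑ T, ∑ σ, fieldCreate (B T) σ * fieldAnnihilate (B T) σ =
      ∑ x : Λ, ∑ y : Λ, ∑ σ : Fin 2,
        (((B.transpose * B) x y : ℝ) : ℂ) • (create (x, σ) * annihilate (y, σ)) := by
    simp only [fieldCreate, fieldAnnihilate, Finset.sum_mul, Finset.mul_sum, smul_mul_assoc,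
      mul_smul_comm, Matrix.mul_apply, Complex.ofReal_sum, Finset.sum_smul]
    symm
    rw [Finset.sum_congr rfl fun x _ => (Finset.sum_congr rfl fun y _ =>
      Finset.sum_comm).trans Finset.sum_comm, Finset.sum_comm]
    refine Finset.sum_congr rfl fun T _ => ?_
    rw [Finset.sum_congr rfl fun x _ => Finset.sum_comm, Finset.sum_comm]
    refine Finset.sum_congr rfl fun σ _ => ?_
    rw [Finset.sum_comm]
    refine Finset.sum_congr rfl fun y _ => ?_
    rw [Finset.smul_sum]
    refine Finset.sum_congr rfl fun x _ => ?_
    rw [smul_smul, Matrix.transpose_apply, Complex.ofReal_mul, mul_comm]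
  have h2 : totalNumber Λ = ∑ x : Λ, ∑ y : Λ, ∑ σ : Fin 2,
        (((1 : Matrix Λ Λ ℝ) x y : ℝ) : ℂ) • (create (x, σ) * annihilate (y, σ)) := by
    simp [totalNumber, number, Matrix.one_apply, ite_smul, apply_ite Complex.ofReal]
  rw [h1, h2, hopping]
  simp only [Finset.smul_sum, smul_smul, ← Finset.sum_sub_distrib, ← sub_smul]
  simp

/-- Writes the interaction as a sum of terms `A†A`, so that its expectation is a sum of squared
norms. -/
theorem number_mul_number {ι : Type*} [Fintype ι] {i j : ι} (hij : i ≠ j) :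
    number i * number j =
      LinearMap.adjoint (annihilate i * annihilate j) * (annihilate i * annihilate j) := by
  classical
  have h : annihilate i * create j = -(create j * annihilate i) := by
    rw [annihilate_mul_create, if_neg hij, zero_sub]
  have h2 : LinearMap.adjoint (annihilate i * annihilate j) = create j * create i :=
    LinearMap.adjoint_comp _ _
  rw [h2, number, number]
  calc _ = create i * (annihilate i * create j) * annihilate j := by
        simp only [mul_assoc]
    _ = -(create i * create j) * annihilate i * annihilate j := by
        rw [h]; simp only [mul_assoc, mul_neg, neg_mul]
    _ = _ := by rw [create_mul_create i j, neg_neg]; simp only [mul_assoc]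

theorem number_up_mul_number_down (x : Λ) :
    number (x, (0 : Fin 2)) * number (x, 1) =
      LinearMap.adjoint (annihilate (x, (0 : Fin 2)) * annihilate (x, 1)) *
        (annihilate (x, (0 : Fin 2)) * annihilate (x, 1)) :=
  number_mul_number (by simp)

/-- The quadratic form of a flat-band Hubbard Hamiltonian, measured from the energy `-2t` per
electron, is a sum of squares. -/
theorem inner_hamiltonian [DecidableEq Λ] (B : Matrix τ Λ ℝ) (t U : ℝ) {N : ℕ} {Φ : State Λ}
    (hΦ : Φ ∈ sector Λ N) :
    inner ℂ Φ (hamiltonian (t • (B.transpose * B) - (2 * t) • (1 : Matrix Λ Λ ℝ))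
        (fun _ => U) Φ) =
      ((t * ∑ T, ∑ σ, ‖fieldAnnihilate (B T) σ Φ‖ ^ 2
        + U * ∑ x : Λ, ‖annihilate (x, 0) (annihilate (x, 1) Φ)‖ ^ 2
        - 2 * t * N * ‖Φ‖ ^ 2 : ℝ) : ℂ) := by
  rw [mem_sector_iff] at hΦ
  have e1 : ∀ A : State Λ →ₗ[ℂ] State Λ,
      inner ℂ Φ (LinearMap.adjoint A (A Φ)) = ((‖A Φ‖ ^ 2 : ℝ) : ℂ) := fun A => by
    rw [LinearMap.adjoint_inner_right, inner_self_eq_norm_sq_to_K]; simp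
  rw [hamiltonian, hopping_gram, interaction]
  simp only [number_up_mul_number_down, ← adjoint_fieldAnnihilate, LinearMap.add_apply,
    LinearMap.sub_apply, LinearMap.smul_apply, LinearMap.sum_apply,
    Module.End.mul_apply (LinearMap.adjoint _), hΦ, inner_add_right, inner_sub_right, inner_smul_right, inner_sum, e1]
  rw [inner_self_eq_norm_sq_to_K]
  push_cast
  simp only [Finset.mul_sum, Module.End.mul_apply, Complex.coe_algebraMap]
  ring

theorem hamiltonian_apply_of_mem_flatSpace [DecidableEq Λ] (B : Matrix τ Λ ℝ) (t U : ℝ) {N : ℕ}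
    {Φ : State Λ} (hN : Φ ∈ sector Λ N) (hΦ : Φ ∈ flatSpace B) :
    hamiltonian (t • (B.transpose * B) - (2 * t) • (1 : Matrix Λ Λ ℝ)) (fun _ => U) Φ =
      ((-2 * t * N : ℝ) : ℂ) • Φ := by
  rw [mem_sector_iff] at hN
  rw [mem_flatSpace_iff] at hΦ
  rw [hamiltonian, hopping_gram, interaction]
  simp only [number_up_mul_number_down, LinearMap.add_apply, LinearMap.sub_apply, LinearMap.smul_apply,
    LinearMap.sum_apply, Module.End.mul_apply, hN, hΦ, map_zero, smul_zero,
    Finset.sum_const_zero]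
  push_cast
  module

/-- The energy above `-2tN` is a sum of squares with positive weights, so it vanishes only if every
term does. -/
theorem energySpace_eq [DecidableEq Λ] (B : Matrix τ Λ ℝ) {t U : ℝ} (ht : 0 < t) (hU : 0 < U)
    (N : ℕ) :
    energySpace (hamiltonian (t • (B.transpose * B) - (2 * t) • (1 : Matrix Λ Λ ℝ))
        (fun _ => U)) N (-2 * t * N) = sector Λ N ⊓ flatSpace B := by
  ext Φ
  rw [energySpace, Submodule.mem_inf, Submodule.mem_inf, and_congr_right_iff]
  intro hN
  rw [Module.End.mem_eigenspace_iff]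
  refine ⟨fun h => ?_, hamiltonian_apply_of_mem_flatSpace B t U hN⟩
  have key := inner_hamiltonian B t U hN
  rw [h, inner_smul_right, inner_self_eq_norm_sq_to_K] at key
  have key' : -2 * t * N * ‖Φ‖ ^ 2 = t * ∑ T, ∑ σ, ‖fieldAnnihilate (B T) σ Φ‖ ^ 2
        + U * ∑ x : Λ, ‖annihilate (x, 0) (annihilate (x, 1) Φ)‖ ^ 2
        - 2 * t * N * ‖Φ‖ ^ 2 := by
    have := congrArg Complex.re key
    simpa [← Complex.ofReal_pow, Complex.ofReal_re] using this
  have n1 : 0 ≤ ∑ T, ∑ σ, ‖fieldAnnihilate (B T) σ Φ‖ ^ 2 := by positivity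
  have n2 : 0 ≤ ∑ x : Λ, ‖annihilate (x, 0) (annihilate (x, 1) Φ)‖ ^ 2 := by positivity
  have z1 : ∑ T, ∑ σ, ‖fieldAnnihilate (B T) σ Φ‖ ^ 2 = 0 := by
    have := mul_nonneg ht.le n1
    have := mul_nonneg hU.le n2
    exact (mul_eq_zero.mp (show t * _ = 0 by linarith)).resolve_left ht.ne'
  have z2 : ∑ x : Λ, ‖annihilate (x, 0) (annihilate (x, 1) Φ)‖ ^ 2 = 0 := by
    have := mul_nonneg ht.le n1
    have := mul_nonneg hU.le n2
    exact (mul_eq_zero.mp (show U * _ = 0 by linarith)).resolve_left hU.ne'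
  rw [mem_flatSpace_iff]
  constructor
  · intro T σ
    rw [Finset.sum_eq_zero_iff_of_nonneg fun _ _ => by positivity] at z1
    have := z1 T (Finset.mem_univ _)
    rw [Finset.sum_eq_zero_iff_of_nonneg fun _ _ => by positivity] at this
    simpa using this σ (Finset.mem_univ _)
  · intro x
    rw [Finset.sum_eq_zero_iff_of_nonneg fun _ _ => by positivity] at z2
    simpa using z2 x (Finset.mem_univ _)

theorem le_of_energySpace_ne_bot [DecidableEq Λ] (B : Matrix τ Λ ℝ) {t U : ℝ} (ht : 0 < t)
    (hU : 0 < U) (N : ℕ) {E : ℝ}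
    (h : energySpace (hamiltonian (t • (B.transpose * B) - (2 * t) • (1 : Matrix Λ Λ ℝ))
        (fun _ => U)) N E ≠ ⊥) : -2 * t * N ≤ E := by
  obtain ⟨Φ, hΦ, h0⟩ := Submodule.exists_mem_ne_zero_of_ne_bot h
  rw [energySpace, Submodule.mem_inf, Module.End.mem_eigenspace_iff] at hΦ
  have key := inner_hamiltonian B t U hΦ.1
  rw [hΦ.2, inner_smul_right, inner_self_eq_norm_sq_to_K] at key
  have key' : E * ‖Φ‖ ^ 2 = t * ∑ T, ∑ σ, ‖fieldAnnihilate (B T) σ Φ‖ ^ 2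
        + U * ∑ x : Λ, ‖annihilate (x, 0) (annihilate (x, 1) Φ)‖ ^ 2
        - 2 * t * N * ‖Φ‖ ^ 2 := by
    have := congrArg Complex.re key
    simpa [← Complex.ofReal_pow, Complex.ofReal_re] using this
  have n1 : 0 ≤ t * ∑ T, ∑ σ, ‖fieldAnnihilate (B T) σ Φ‖ ^ 2 := by positivity
  have n2 : 0 ≤ U * ∑ x : Λ, ‖annihilate (x, 0) (annihilate (x, 1) Φ)‖ ^ 2 := by positivity
  have hp : 0 < ‖Φ‖ ^ 2 := by positivity
  exact le_of_mul_le_mul_right (by linarith) hp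

end GroundSpace

/-! ### The spin multiplet of the fully polarized state. -/

section Multiplet

variable {Λ τ : Type*} [Fintype Λ]

theorem fieldAnnihilate_single [DecidableEq Λ] (x : Λ) (σ : Fin 2) :
    fieldAnnihilate (Pi.single x 1) σ = annihilate (x, σ) := by
  simp [fieldAnnihilate, Pi.single_apply, apply_ite Complex.ofReal, ite_smul]

theorem fieldAnnihilate_mul_spinOp (g : Λ → ℝ) (σ : Fin 2) (p : Matrix (Fin 2) (Fin 2) ℂ) :
    fieldAnnihilate g σ * spinOp Λ p =
      spinOp Λ p * fieldAnnihilate g σ + ∑ τ, p σ τ • fieldAnnihilate g τ := by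
  simp only [fieldAnnihilate, Finset.sum_mul, Finset.mul_sum, smul_mul_assoc, mul_smul_comm,
    annihilate_mul_spinOp, smul_add, Finset.sum_add_distrib, Finset.smul_sum]
  congr 1
  rw [Finset.sum_comm]
  exact Finset.sum_congr rfl fun _ _ => Finset.sum_congr rfl fun _ _ => smul_comm _ _ _

/-- Commuting a row operator with the lowering operator gives at most the same row with the other
spin. For the pair at `x`, only `c_{x,↓}` has a nonzero commutator, namely `c_{x,↑}`, and `c_{x,↑}²
= 0`. -/
theorem spinLower_mem_flatSpace {B : Matrix τ Λ ℝ} {Φ : State Λ} (h : Φ ∈ flatSpace B) :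
    spinLower Λ Φ ∈ flatSpace B := by
  have hs := fun i => annihilate_mem_flatSpace h i
  rw [mem_flatSpace_iff] at h ⊢
  refine ⟨fun T σ => ?_, fun x => ?_⟩
  · have := congrArg (fun f => f Φ) (fieldAnnihilate_mul_spinOp (B T) σ !![0, 0; 1, 0])
    simpa [h.1, spinLower] using this
  · have e0 := annihilate_mul_spinOp x 0 !![0, 0; 1, 0]
    have e1 := annihilate_mul_spinOp x 1 !![0, 0; 1, 0]
    simp only [Fin.sum_univ_two] at e0 e1
    have e0' := congrArg (fun f => f (annihilate (x, 1) Φ)) e0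
    have e1' := congrArg (fun f => f Φ) e1
    have e2 := congrArg (fun f => f Φ) (annihilate_mul_self (x, (0 : Fin 2)))
    simp [h.2] at e0' e1' e2
    rw [spinLower, e1', map_add, e0', e2, add_zero]

open scoped Classical in
/-- The state without electrons. -/
noncomputable def vacuum (ι : Type*) [Fintype ι] : Fock ι := EuclideanSpace.single ∅ 1

/-- The state with all electrons in spin-up states, one in each element of the list. -/
noncomputable def upState (L : List (Λ → ℝ)) : State Λ :=
  L.foldr (fun f Φ => fieldCreate f 0 Φ) (vacuum _)

theorem upState_nil : upState ([] : List (Λ → ℝ)) = vacuum _ := rfl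

theorem upState_cons (f : Λ → ℝ) (L : List (Λ → ℝ)) :
    upState (f :: L) = fieldCreate f 0 (upState L) := rfl

theorem annihilate_vacuum {ι : Type*} [Fintype ι] (i : ι) :
    annihilate i (vacuum ι) = 0 := by
  classical
  rw [vacuum, annihilate_single]; simp

theorem fieldAnnihilate_vacuum (g : Λ → ℝ) (σ : Fin 2) :
    fieldAnnihilate g σ (vacuum _) = 0 := by
  simp [fieldAnnihilate, LinearMap.sum_apply, annihilate_vacuum]

theorem fieldAnnihilate_upState (g : Λ → ℝ) (σ : Fin 2) (L : List (Λ → ℝ))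
    (h : σ = 0 → ∀ f ∈ L, g ⬝ᵥ f = 0) : fieldAnnihilate g σ (upState L) = 0 := by
  induction L with
  | nil => rw [upState_nil, fieldAnnihilate_vacuum]
  | cons f L ih =>
    have e := congrArg (fun A => A (upState L)) (fieldAnnihilate_mul_fieldCreate g f σ 0)
    simp only [Module.End.mul_apply, LinearMap.sub_apply, LinearMap.smul_apply,
      ih fun hσ f hf => h hσ f (List.mem_cons_of_mem _ hf), map_zero, sub_zero] at e
    rw [upState_cons, e]
    split_ifs with hσ
    · simp [h hσ f List.mem_cons_self]
    · simp

theorem annihilate_upState (i : Λ × Fin 2) (L : List (Λ → ℝ))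
    (h : i.2 = 0 → ∀ f ∈ L, f i.1 = 0) : annihilate i (upState L) = 0 := by
  classical
  obtain ⟨x, σ⟩ := i
  rw [← fieldAnnihilate_single]
  exact fieldAnnihilate_upState _ _ _ fun hσ f hf => by simpa using h hσ f hf

theorem vacuum_mem_sector : vacuum _ ∈ sector Λ 0 := by
  rw [mem_sector_iff, totalNumber_eq_sum]
  simp [LinearMap.sum_apply, number, annihilate_vacuum]

theorem upState_mem_sector (L : List (Λ → ℝ)) : upState L ∈ sector Λ L.length := by
  induction L with
  | nil => exact vacuum_mem_sector
  | cons f L ih =>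
    rw [upState_cons, fieldCreate, LinearMap.sum_apply]
    exact Submodule.sum_mem _ fun x _ => Submodule.smul_mem _ _ (create_mem_sector ih _)

theorem upState_mem_flatSpace {B : Matrix τ Λ ℝ} {L : List (Λ → ℝ)}
    (h : ∀ f ∈ L, ∀ T, B T ⬝ᵥ f = 0) : upState L ∈ flatSpace B := by
  rw [mem_flatSpace_iff]
  refine ⟨fun T σ => fieldAnnihilate_upState _ _ _ fun _ f hf => h f hf T, fun x => ?_⟩
  rw [annihilate_upState (x, 1) L (by simp), map_zero]

theorem spinRaise_upState (L : List (Λ → ℝ)) : spinRaise Λ (upState L) = 0 := by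
  have h := fun x : Λ => annihilate_upState (x, 1) L (by simp)
  rw [spinRaise, spinOp_eq_sum]
  simp [LinearMap.sum_apply, h]

theorem totalSpin_two_upState (L : List (Λ → ℝ)) :
    totalSpin Λ 2 (upState L) = ((L.length : ℂ) / 2) • upState L := by
  have h := fun x : Λ => annihilate_upState (x, 1) L (by simp)
  have hN := (mem_sector_iff _ _).mp (upState_mem_sector L)
  rw [div_eq_inv_mul, mul_smul, ← hN, totalNumber, totalSpin_eq_spinOp, spinOp_eq_sum]
  simp [LinearMap.sum_apply, h, number, pauli]

/-- Annihilating at `z i` removes the factor `f i` and no other, since the remaining functions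
vanish there; peeling off all factors ends at the vacuum. -/
theorem upState_map_ne_zero {κ : Type*} [DecidableEq κ] {f : κ → Λ → ℝ} {z : κ → Λ}
    (hfz : ∀ i j, f i (z j) = if i = j then 1 else 0) {l : List κ} (hl : l.Nodup) :
    upState (l.map f) ≠ 0 := by
  induction l with
  | nil =>
    intro h
    have := congrArg (fun Φ : State Λ => Φ ∅) h
    simp [upState_nil, vacuum] at this
  | cons i l ih =>
    rw [List.nodup_cons] at hl
    intro h
    refine ih hl.2 ?_
    have e := congrArg (fun A => A (upState (l.map f)))
      (annihilate_mul_fieldCreate (z i) 0 0 (f i))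
    have h0 : annihilate (z i, 0) (upState (l.map f)) = 0 := by
      refine annihilate_upState _ _ fun _ g hg => ?_
      obtain ⟨j, hj, rfl⟩ := List.mem_map.mp hg
      rw [hfz, if_neg]
      rintro rfl
      exact hl.1 hj
    rw [List.map_cons, upState_cons] at h
    simpa [h0, hfz, h] using e.symm

/-- The spin multiplet obtained from a fully polarized state by lowering the spin. -/
theorem spinLower_pow_upState (L : List (Λ → ℝ)) (k : ℕ) :
    totalSpin Λ 2 ((spinLower Λ ^ k) (upState L)) =
        ((L.length : ℂ) / 2 - k) • (spinLower Λ ^ k) (upState L) ∧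
      spinRaise Λ ((spinLower Λ ^ (k + 1)) (upState L)) =
        (((k : ℂ) + 1) * (L.length - k)) • (spinLower Λ ^ k) (upState L) := by
  have eZ := fun Ψ => congrArg (fun A => A Ψ) (totalSpin_two_mul_spinLower (Λ := Λ))
  have eR := fun Ψ => congrArg (fun A => A Ψ) (spinRaise_mul_spinLower (Λ := Λ))
  simp only [Module.End.mul_apply, LinearMap.sub_apply, LinearMap.add_apply,
    LinearMap.smul_apply] at eZ eR
  induction k with
  | zero =>
    refine ⟨by simpa using totalSpin_two_upState L, ?_⟩
    rw [zero_add, pow_one, eR, spinRaise_upState, totalSpin_two_upState]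
    simp only [map_zero, pow_zero, Module.End.one_apply, Nat.cast_zero]
    module
  | succ k ih =>
    have hZ : totalSpin Λ 2 ((spinLower Λ ^ (k + 1)) (upState L)) =
        ((L.length : ℂ) / 2 - (k + 1 : ℕ)) • (spinLower Λ ^ (k + 1)) (upState L) := by
      rw [pow_succ', Module.End.mul_apply, eZ, ih.1, map_smul]
      push_cast
      module
    refine ⟨hZ, ?_⟩
    rw [pow_succ', Module.End.mul_apply, eR, ih.2, hZ, map_smul, ← Module.End.mul_apply,
      ← pow_succ']
    push_cast
    module

/-- Raising undoes lowering up to the factor `(k + 1)(N - k)`, where `N` is the length of `L`; it is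
nonzero for `k < N`. -/
theorem spinLower_pow_upState_ne_zero {L : List (Λ → ℝ)} (hL : upState L ≠ 0) {k : ℕ}
    (hk : k ≤ L.length) : (spinLower Λ ^ k) (upState L) ≠ 0 := by
  induction k with
  | zero => simpa using hL
  | succ k ih =>
    intro h
    have e := (spinLower_pow_upState L k).2
    rw [h, map_zero, eq_comm, smul_eq_zero] at e
    refine absurd (e.resolve_right (ih (by omega))) ?_
    refine mul_ne_zero (Nat.cast_add_one_ne_zero k) (sub_ne_zero.mpr ?_)
    exact_mod_cast (show L.length ≠ k by omega)

theorem totalSpinSq_spinLower_pow_upState (L : List (Λ → ℝ)) (k : ℕ) :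
    totalSpinSq Λ ((spinLower Λ ^ k) (upState L)) =
      (((L.length : ℂ) / 2) * ((L.length : ℂ) / 2 + 1)) • (spinLower Λ ^ k) (upState L) := by
  have hLR : spinLower Λ (spinRaise Λ ((spinLower Λ ^ k) (upState L))) =
      ((k : ℂ) * (L.length - k + 1)) • (spinLower Λ ^ k) (upState L) := by
    cases k with
    | zero => simp [spinRaise_upState]
    | succ k =>
      rw [(spinLower_pow_upState L k).2, map_smul, ← Module.End.mul_apply, ← pow_succ']
      push_cast
      module
  rw [totalSpinSq_eq, LinearMap.add_apply, LinearMap.add_apply, Module.End.mul_apply, hLR,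
    pow_two, Module.End.mul_apply, (spinLower_pow_upState L k).1, map_smul,
    (spinLower_pow_upState L k).1]
  module

theorem spinLower_pow_mem {B : Matrix τ Λ ℝ} {N : ℕ} {Φ : State Λ}
    (h : Φ ∈ sector Λ N ⊓ flatSpace B) (k : ℕ) :
    (spinLower Λ ^ k) Φ ∈ sector Λ N ⊓ flatSpace B := by
  induction k with
  | zero => simpa using h
  | succ k ih =>
    rw [pow_succ', Module.End.mul_apply]
    exact ⟨secondQuant_mem_sector ih.1 _, spinLower_mem_flatSpace ih.2⟩

end Multiplet

end Hubbard

/-- A space of dimension at most `n` that contains `n` eigenvectors of an operator for different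
eigenvalues is spanned by them, and its intersections with the eigenspaces are lines. -/
theorem Module.End.span_eq_of_finrank_le {K V : Type*} [Field K] [AddCommGroup V] [Module K V]
    [FiniteDimensional K V] (A : Module.End K V) (E : Submodule K V) {n : ℕ}
    (hE : Module.finrank K E ≤ n) (v : Fin n → V) (μ : Fin n → K) (hμ : Function.Injective μ)
    (hv : ∀ k, v k ∈ E) (h0 : ∀ k, v k ≠ 0) (hA : ∀ k, A (v k) = μ k • v k) :
    Submodule.span K (Set.range v) = E ∧ Module.finrank K E = n ∧
      ∀ k, Module.finrank K ↥(E ⊓ Module.End.eigenspace A (μ k)) = 1 := by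
  have hli : LinearIndependent K v := Module.End.eigenvectors_linearIndependent' A μ hμ v
    fun k => Module.End.hasEigenvector_iff.mpr ⟨Module.End.mem_eigenspace_iff.mpr (hA k), h0 k⟩
  have hfr : Module.finrank K (Submodule.span K (Set.range v)) = n := by
    simpa using finrank_span_eq_card hli
  have hsp : Submodule.span K (Set.range v) = E := by
    refine Submodule.eq_of_le_of_finrank_le (Submodule.span_le.mpr ?_) (hE.trans hfr.ge)
    rintro _ ⟨k, rfl⟩
    exact hv k
  refine ⟨hsp, hsp ▸ hfr, fun k => ?_⟩
  have : E ⊓ Module.End.eigenspace A (μ k) = Submodule.span K {v k} := by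
    refine le_antisymm ?_ ?_
    · rintro x ⟨hx, hx'⟩
      rw [SetLike.mem_coe, ← hsp, Submodule.mem_span_range_iff_exists_fun] at hx
      obtain ⟨a, rfl⟩ := hx
      rw [SetLike.mem_coe, Module.End.mem_eigenspace_iff] at hx'
      -- Independence then kills every coefficient except that of `v k`, because the eigenvalues are
      -- distinct.
      have hz : ∑ j, (a j * (μ j - μ k)) • v j = 0 := by
        rw [map_sum, Finset.smul_sum, ← sub_eq_zero, ← Finset.sum_sub_distrib] at hx'
        rw [← hx']
        refine Finset.sum_congr rfl fun j _ => ?_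
        rw [map_smul, hA]
        module
      have hz' := Fintype.linearIndependent_iff.mp hli _ hz
      rw [Finset.sum_eq_single k]
      · exact Submodule.smul_mem _ _ (Submodule.mem_span_singleton_self _)
      · intro j _ hj
        rw [(mul_eq_zero.mp (hz' j)).resolve_right (sub_ne_zero.mpr (hμ.ne hj)), zero_smul]
      · simp
    · rw [Submodule.span_singleton_le_iff_mem]
      exact ⟨hv k, Module.End.mem_eigenspace_iff.mpr (hA k)⟩
  rw [this, finrank_span_singleton (h0 k)]

namespace Hubbard

/-! ### Products of annihilation operators. -/

section AnnihilateList

variable {ι : Type*} [Fintype ι]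

/-- The product of the annihilation operators of a list of modes. -/
noncomputable def annihilateList (l : List ι) : Fock ι →ₗ[ℂ] Fock ι := (l.map annihilate).prod

theorem annihilateList_nil : annihilateList ([] : List ι) = 1 := rfl

theorem annihilateList_cons (i : ι) (l : List ι) :
    annihilateList (i :: l) = annihilate i * annihilateList l := by
  simp [annihilateList]

theorem annihilateList_append (l l' : List ι) :
    annihilateList (l ++ l') = annihilateList l * annihilateList l' := by
  simp [annihilateList]

theorem annihilate_mul_annihilateList (i : ι) (l : List ι) :
    ∃ ε : ℂ, annihilate i * annihilateList l = ε • (annihilateList l * annihilate i) := by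
  induction l with
  | nil => exact ⟨1, by simp [annihilateList_nil]⟩
  | cons j l ih =>
    obtain ⟨ε, hε⟩ := ih
    refine ⟨-ε, ?_⟩
    rw [annihilateList_cons, ← mul_assoc, annihilate_mul_annihilate i j, neg_mul, mul_assoc, hε,
      mul_smul_comm, mul_assoc, neg_smul]

theorem annihilateList_apply_eq_zero {i : ι} {l : List ι} (hi : i ∈ l) {Φ : Fock ι}
    (h : annihilate i Φ = 0) : annihilateList l Φ = 0 := by
  induction l with
  | nil => simp at hi
  | cons j l ih =>
    rw [annihilateList_cons]
    rcases List.mem_cons.mp hi with rfl | hi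
    · obtain ⟨ε, hε⟩ := annihilate_mul_annihilateList i l
      rw [hε, LinearMap.smul_apply, Module.End.mul_apply, h, map_zero, smul_zero]
    · rw [Module.End.mul_apply, ih hi, map_zero]

/-- The scalar depends on the reordering alone. Having it before `g` lets different spin assignments
on the same sites be compared with one common factor. -/
theorem exists_annihilateList_eq_smul_of_perm {κ : Type*} {l l' : List κ} (h : l.Perm l') :
    ∃ ε : ℂ, ∀ g : κ → ι, annihilateList (l.map g) = ε • annihilateList (l'.map g) := by
  induction h with
  | nil => exact ⟨1, fun g => by simp⟩
  | cons a _ ih =>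
    obtain ⟨ε, hε⟩ := ih
    exact ⟨ε, fun g => by
      rw [List.map_cons, List.map_cons, annihilateList_cons, annihilateList_cons, hε,
        mul_smul_comm]⟩
  | swap a b l =>
    exact ⟨-1, fun g => by
      simp only [List.map_cons, annihilateList_cons, ← mul_assoc]
      rw [annihilate_mul_annihilate, neg_mul, neg_one_smul]⟩
  | trans _ _ ih ih' =>
    obtain ⟨ε, hε⟩ := ih
    obtain ⟨ε', hε'⟩ := ih'
    exact ⟨ε * ε', fun g => by rw [hε, hε', mul_smul]⟩

end AnnihilateList

/-! ### Amplitudes at the dual points and the upper bound on the dimension. -/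

section Amplitudes

variable {Λ τ : Type*} [Fintype Λ] {B : Matrix τ Λ ℝ} {M : ℕ} {f : Fin M → Λ → ℝ}
  {z : Fin M → Λ}

theorem annihilate_annihilate_of_mem_flatSpace {Φ : State Λ} (h : Φ ∈ flatSpace B) (x : Λ)
    (a b : Fin 2) : annihilate (x, a) (annihilate (x, b) Φ) = 0 := by
  have e := fun i j : Λ × Fin 2 => congrArg (fun A => A Φ) (annihilate_mul_annihilate i j)
  have e' := fun i : Λ × Fin 2 => congrArg (fun A => A Φ) (annihilate_mul_self i)
  simp only [Module.End.mul_apply, LinearMap.neg_apply, LinearMap.zero_apply] at e e'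
  rw [mem_flatSpace_iff] at h
  by_cases hab : a = b
  · rw [hab, e']
  · obtain ⟨rfl, rfl⟩ | ⟨rfl, rfl⟩ : (a = 0 ∧ b = 1) ∨ (a = 1 ∧ b = 0) := by omega
    · exact h.2 x
    · rw [e, h.2 x, neg_zero]

theorem annihilateList_apply_of_not_nodup {Φ : State Λ} (h : Φ ∈ flatSpace B)
    {L : List (Λ × Fin 2)} (hL : ¬ (L.map Prod.fst).Nodup) : annihilateList L Φ = 0 := by
  induction L with
  | nil => simp at hL
  | cons a L ih =>
    rw [annihilateList_cons]
    by_cases hL' : (L.map Prod.fst).Nodup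
    · have ha : a.1 ∈ L.map Prod.fst := by
        by_contra ha
        exact hL (List.nodup_cons.mpr ⟨ha, hL'⟩)
      obtain ⟨b, hb, hba⟩ := List.mem_map.mp ha
      obtain ⟨ε, hε⟩ := annihilate_mul_annihilateList a L
      rw [hε, LinearMap.smul_apply, Module.End.mul_apply, annihilateList_apply_eq_zero hb,
        smul_zero]
      obtain ⟨x, s⟩ := a
      obtain ⟨y, s'⟩ := b
      obtain rfl : y = x := hba
      exact annihilate_annihilate_of_mem_flatSpace h _ _ _
    · rw [Module.End.mul_apply, ih hL', map_zero]

theorem fieldAnnihilate_add (g g' : Λ → ℝ) (σ : Fin 2) :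
    fieldAnnihilate (g + g') σ = fieldAnnihilate g σ + fieldAnnihilate g' σ := by
  simp [fieldAnnihilate, add_smul, Finset.sum_add_distrib]

theorem fieldAnnihilate_sum_smul {κ : Type*} [Fintype κ] (a : κ → ℝ) (g : κ → Λ → ℝ)
    (σ : Fin 2) :
    fieldAnnihilate (∑ i, a i • g i) σ = ∑ i, (a i : ℂ) • fieldAnnihilate (g i) σ := by
  simp only [fieldAnnihilate, Finset.sum_apply, Pi.smul_apply, smul_eq_mul, Complex.ofReal_sum,
    Complex.ofReal_mul, Finset.sum_smul, Finset.smul_sum, smul_smul]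
  exact Finset.sum_comm

/-- The operator `c_{z_0,σ_0} c_{z_1,σ_1} ⋯` that extracts the amplitude of the configuration in
which the site `z_i` carries an electron with spin `σ_i`. -/
noncomputable def spinAmplitude (z : Fin M → Λ) (σ : Fin M → Fin 2) : State Λ →ₗ[ℂ] State Λ :=
  annihilateList ((List.finRange M).map fun i => (z i, σ i))

theorem spinAmplitude_mem_sector {Φ : State Λ} (hN : Φ ∈ sector Λ M) (σ : Fin M → Fin 2) :
    spinAmplitude z σ Φ ∈ sector Λ 0 := by
  have key : ∀ (L : List (Λ × Fin 2)) (N : ℕ), Φ ∈ sector Λ (L.length + N) →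
      annihilateList L Φ ∈ sector Λ N := by
    intro L
    induction L with
    | nil => intro N h; simpa [annihilateList_nil] using h
    | cons i L ih =>
      intro N h
      rw [annihilateList_cons]
      refine annihilate_mem_sector (ih (N + 1) ?_) i
      rw [List.length_cons] at h
      rwa [show L.length + (N + 1) = L.length + 1 + N by ring]
  exact key _ 0 (by simpa using hN)

/-- Two spin assignments with equally many up spins have fibres of equal size, hence differ by a
permutation; `k` is the number of up spins. -/
theorem exists_perm_comp_eq (σ : Fin M → Fin 2) :
    ∃ (k : Fin (M + 1)) (π : Equiv.Perm (Fin M)),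
      σ = (fun i : Fin M => if i.val < k then (0 : Fin 2) else 1) ∘ π := by
  classical
  have hk : (Finset.univ.filter fun i => σ i = 0).card ≤ M := by
    simpa using Finset.card_filter_le (Finset.univ : Finset (Fin M)) fun i => σ i = 0
  set k := (Finset.univ.filter fun i => σ i = 0).card with hkdef
  set g : Fin M → Fin 2 := fun i => if i.val < k then (0 : Fin 2) else 1 with hg
  have h0 : Fintype.card {i // σ i = 0} = Fintype.card {i // g i = 0} := by
    rw [Fintype.card_subtype, Fintype.card_subtype, ← hkdef]
    have : (Finset.univ.filter fun i => g i = 0) = Finset.univ.filter fun i : Fin M => i.val < k :=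
      Finset.filter_congr fun i _ => by simp [hg]
    rw [this, Fin.card_filter_val_lt, min_eq_right hk]
  have h1 : Fintype.card {i // σ i = 1} = Fintype.card {i // g i = 1} := by
    have e : ∀ s : Fin 2, s = 1 ↔ ¬ s = 0 := by decide
    simp only [e]
    rw [Fintype.card_subtype_compl, Fintype.card_subtype_compl, h0]
  have e : ∀ c, Nonempty ({i // σ i = c} ≃ {i // g i = c}) := by
    intro c
    rw [← Fintype.card_eq]
    obtain rfl | rfl : c = 0 ∨ c = 1 := by omega
    · exact h0
    · exact h1
  refine ⟨⟨k, Nat.lt_succ_of_le hk⟩, Equiv.ofFiberEquiv fun c => (e c).some, ?_⟩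
  funext i
  exact (Equiv.ofFiberEquiv_map (fun c => (e c).some) i).symm


variable [Fintype τ] [DecidableEq Λ]

theorem annihilate_eq_sum_of_mem_flatSpace
    (hB : ∀ x, ∃ ψ : τ → ℝ, Pi.single x (1 : ℝ) =
      ∑ i, f i x • Pi.single (z i) (1 : ℝ) + ∑ T, ψ T • B T)
    {Φ : State Λ} (h : Φ ∈ flatSpace B) (x : Λ) (σ : Fin 2) :
    annihilate (x, σ) Φ = ∑ i, (f i x : ℂ) • annihilate (z i, σ) Φ := by
  obtain ⟨ψ, hψ⟩ := hB x
  rw [mem_flatSpace_iff] at h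
  rw [← fieldAnnihilate_single, hψ, fieldAnnihilate_add, fieldAnnihilate_sum_smul,
    fieldAnnihilate_sum_smul ψ B]
  simp [LinearMap.sum_apply, h.1, fieldAnnihilate_single]

/-- Expand `c_{x,a} c_{x,b} Φ = 0` in the operators at the `z k` and annihilate the electrons at all
points other than `z i`, `z j`. What is left is `f i x * f j x` times the sum of two amplitudes,
whose relative sign is turned by anticommutation. -/
theorem spinAmplitude_comp_swap
    (hB : ∀ x, ∃ ψ : τ → ℝ, Pi.single x (1 : ℝ) =
      ∑ i, f i x • Pi.single (z i) (1 : ℝ) + ∑ T, ψ T • B T)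
    {i j : Fin M} {x : Λ} (hij : i ≠ j) (hx : f i x * f j x ≠ 0) {Φ : State Λ}
    (h : Φ ∈ flatSpace B) (σ : Fin M → Fin 2) :
    spinAmplitude z (σ ∘ Equiv.swap i j) Φ = spinAmplitude z σ Φ := by
  set R : List (Fin M) := (List.finRange M).filter fun k => k ≠ i ∧ k ≠ j with hR
  have memR : ∀ k, k ∈ R ↔ k ≠ i ∧ k ≠ j := fun k => by simp [hR]
  have hperm : (List.finRange M).Perm (R ++ [i, j]) := by
    rw [List.perm_ext_iff_of_nodup (List.nodup_finRange M)]
    · intro k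
      simp only [List.mem_finRange, List.mem_append, memR, List.mem_cons, List.not_mem_nil,
        or_false, true_iff]
      tauto
    · refine List.Nodup.append ((List.nodup_finRange M).filter _) (by simpa using hij) ?_
      intro k hk hk'
      rw [memR] at hk
      simp only [List.mem_cons, List.not_mem_nil, or_false] at hk'
      tauto
  obtain ⟨ε, hε⟩ := exists_annihilateList_eq_smul_of_perm (ι := Λ × Fin 2) hperm
  have hW : ∀ ρ : Fin M → Fin 2, spinAmplitude z ρ Φ =
      ε • annihilateList (R.map fun k => (z k, ρ k))
        (annihilate (z i, ρ i) (annihilate (z j, ρ j) Φ)) := fun ρ => by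
    rw [spinAmplitude, hε, List.map_append, annihilateList_append]
    simp [annihilateList_cons, annihilateList_nil]
  have hRσ : (R.map fun k => (z k, (σ ∘ Equiv.swap i j) k)) = R.map fun k => (z k, σ k) := by
    refine List.map_congr_left fun k hk => ?_
    rw [memR] at hk
    rw [Function.comp_apply, Equiv.swap_apply_of_ne_of_ne hk.1 hk.2]
  rw [hW, hW, hRσ, Function.comp_apply, Function.comp_apply, Equiv.swap_apply_left,
    Equiv.swap_apply_right]
  congr 1
  generalize σ i = b
  generalize σ j = a
  set W := annihilateList (R.map fun k => (z k, σ k)) with hWdef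
  have anti := fun i j : Λ × Fin 2 => congrArg (fun A => A Φ) (annihilate_mul_annihilate i j)
  simp only [Module.End.mul_apply, LinearMap.neg_apply] at anti
  have hkill : ∀ k ∈ R, ∀ s (Ψ : State Λ), Ψ ∈ flatSpace B → W (annihilate (z k, s) Ψ) = 0 :=
    fun k hk s Ψ hΨ => annihilateList_apply_eq_zero (List.mem_map.mpr ⟨k, hk, rfl⟩)
      (annihilate_annihilate_of_mem_flatSpace hΨ _ _ _)
  have hexp : ∑ k, ∑ l, ((f k x : ℂ) * f l x) •
      W (annihilate (z k, a) (annihilate (z l, b) Φ)) = 0 := by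
    have e := annihilate_annihilate_of_mem_flatSpace h x a b
    rw [annihilate_eq_sum_of_mem_flatSpace hB (annihilate_mem_flatSpace h _)] at e
    simp only [annihilate_eq_sum_of_mem_flatSpace hB h x b, map_sum, map_smul, Finset.smul_sum,
      smul_smul] at e
    have e' := congrArg W e
    simpa only [map_sum, map_smul, map_zero] using e'
  have hzero1 : ∀ k, k ≠ i ∧ k ≠ j → ∀ l, W (annihilate (z k, a) (annihilate (z l, b) Φ)) = 0 :=
    fun k hk l => hkill k ((memR k).mpr hk) _ _ (annihilate_mem_flatSpace h _)
  have hzero2 : ∀ l, l ≠ i ∧ l ≠ j → ∀ k, W (annihilate (z k, a) (annihilate (z l, b) Φ)) = 0 :=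
    fun l hl k => by
      rw [anti, map_neg, hkill l ((memR l).mpr hl) _ _ (annihilate_mem_flatSpace h _), neg_zero]
  have hzero3 : ∀ k, W (annihilate (z k, a) (annihilate (z k, b) Φ)) = 0 := fun k => by
    rw [annihilate_annihilate_of_mem_flatSpace h, map_zero]
  -- `W` already annihilates at every other point, and equal indices are double occupancies; only
  -- the terms `(i, j)` and `(j, i)` survive.
  rw [Fintype.sum_eq_add i j hij (fun k hk => by simp [hzero1 k hk]),
    Fintype.sum_eq_add i j hij (fun l hl => by simp [hzero2 l hl]),
    Fintype.sum_eq_add i j hij (fun l hl => by simp [hzero2 l hl]), hzero3, hzero3, smul_zero,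
    smul_zero, zero_add, add_zero, mul_comm (f j x : ℂ), ← smul_add] at hexp
  have hne : (f i x : ℂ) * f j x ≠ 0 := by exact_mod_cast hx
  have := (smul_eq_zero.mp hexp).resolve_left hne
  rw [add_eq_zero_iff_eq_neg, anti (z j, a), map_neg, neg_neg] at this
  exact this

theorem spinAmplitude_comp_perm
    (hB : ∀ x, ∃ ψ : τ → ℝ, Pi.single x (1 : ℝ) =
      ∑ i, f i x • Pi.single (z i) (1 : ℝ) + ∑ T, ψ T • B T)
    (hconn : ∀ r : Fin M → Fin M → Prop, Equivalence r →
      (∀ i j x, f i x * f j x ≠ 0 → r i j) → ∀ i j, r i j)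
    (π : Equiv.Perm (Fin M)) {Φ : State Λ} (h : Φ ∈ flatSpace B) (σ : Fin M → Fin 2) :
    spinAmplitude z (σ ∘ π) Φ = spinAmplitude z σ Φ := by
  have hswap : ∀ i j, ∀ σ : Fin M → Fin 2,
      spinAmplitude z (σ ∘ Equiv.swap i j) Φ = spinAmplitude z σ Φ := by
    -- Invariance under the swap of `i` and `j`, for all `σ` at once, is an equivalence relation;
    -- transitivity comes from conjugating one transposition by another.
    refine hconn _ ⟨fun i σ => by simp, fun {i j} hr σ => by rw [Equiv.swap_comm, hr],
      fun {i j k} h1 h2 σ => ?_⟩ fun i j x hx σ => ?_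
    · by_cases hik : i = k
      · subst hik; simp
      by_cases hij : i = j
      · subst hij; exact h2 σ
      have e : Equiv.swap i k = Equiv.swap j k * Equiv.swap i j * Equiv.swap j k := by
        rw [Equiv.swap_mul_swap_mul_swap hij hik, Equiv.swap_comm]
      rw [e, Equiv.Perm.coe_mul, Equiv.Perm.coe_mul, ← Function.comp_assoc,
        ← Function.comp_assoc, h2, h1, h2]
    · by_cases hij : i = j
      · subst hij; simp
      · exact spinAmplitude_comp_swap hB hij hx h σ
  induction π using Equiv.Perm.swap_induction_on generalizing σ with
  | one => simp
  | swap_mul π i j _ ih =>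
    rw [Equiv.Perm.coe_mul, ← Function.comp_assoc, ih, hswap]

theorem eq_zero_of_annihilateList
    (hB : ∀ x, ∃ ψ : τ → ℝ, Pi.single x (1 : ℝ) =
      ∑ i, f i x • Pi.single (z i) (1 : ℝ) + ∑ T, ψ T • B T)
    {N : ℕ} {Φ : State Λ} (hN : Φ ∈ sector Λ N) (h : Φ ∈ flatSpace B)
    (h0 : ∀ L : List (Fin M × Fin 2), L.length = N →
      annihilateList (L.map fun k => (z k.1, k.2)) Φ = 0) : Φ = 0 := by
  induction N generalizing Φ with
  | zero => simpa [annihilateList_nil] using h0 [] rfl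
  | succ N ih =>
    refine eq_zero_of_forall_annihilate hN fun ⟨x, s⟩ => ?_
    rw [annihilate_eq_sum_of_mem_flatSpace hB h]
    refine Finset.sum_eq_zero fun i _ => ?_
    rw [ih (annihilate_mem_sector hN _) (annihilate_mem_flatSpace h _), smul_zero]
    intro L hL
    have := h0 (L ++ [(i, s)]) (by simp [hL])
    simpa [annihilateList_append, annihilateList_cons, annihilateList_nil] using this

/-- A list of `M` annihilations at the points `z k` either repeats a point, and gives zero, or
visits each index once, and is then a multiple of some `spinAmplitude`. -/
theorem eq_zero_of_spinAmplitude
    (hB : ∀ x, ∃ ψ : τ → ℝ, Pi.single x (1 : ℝ) =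
      ∑ i, f i x • Pi.single (z i) (1 : ℝ) + ∑ T, ψ T • B T)
    {Φ : State Λ} (hN : Φ ∈ sector Λ M) (h : Φ ∈ flatSpace B)
    (h0 : ∀ σ, spinAmplitude z σ Φ = 0) : Φ = 0 := by
  refine eq_zero_of_annihilateList hB hN h fun L hL => ?_
  by_cases hnd : (L.map Prod.fst).Nodup
  · have hperm : (L.map Prod.fst).Perm (List.finRange M) := by
      rw [List.perm_ext_iff_of_nodup hnd (List.nodup_finRange M)]
      have huniv : (L.map Prod.fst).toFinset = Finset.univ := by
        rw [← Finset.card_eq_iff_eq_univ, List.toFinset_card_of_nodup hnd, List.length_map, hL,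
          Fintype.card_fin]
      intro k
      simp only [List.mem_finRange, iff_true]
      rw [← List.mem_toFinset, huniv]
      exact Finset.mem_univ k
    obtain ⟨ε, hε⟩ := exists_annihilateList_eq_smul_of_perm (ι := Λ × Fin 2) hperm
    obtain ⟨σ, hσ⟩ : ∃ σ : Fin M → Fin 2, ∀ a ∈ L, σ a.1 = a.2 := by
      have hinj := List.inj_on_of_nodup_map hnd
      have hex : ∀ k, ∃ s, (k, s) ∈ L := fun k => by
        have : k ∈ L.map Prod.fst := hperm.symm.subset (List.mem_finRange k)
        obtain ⟨⟨k', s⟩, ha, rfl⟩ := List.mem_map.mp this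
        exact ⟨s, ha⟩
      choose σ hσ using hex
      exact ⟨σ, fun a ha => congrArg Prod.snd (hinj (hσ a.1) ha rfl)⟩
    have e : L.map (fun k => (z k.1, k.2)) = (L.map Prod.fst).map fun k => (z k, σ k) := by
      rw [List.map_map]
      exact List.map_congr_left fun a ha => by simp [hσ a ha]
    rw [e, hε, LinearMap.smul_apply]
    exact smul_eq_zero_of_right _ (h0 σ)
  · refine annihilateList_apply_of_not_nodup h fun hnd' => hnd ?_
    rw [List.map_map] at hnd'
    refine List.Nodup.of_map z ?_
    rw [List.map_map]
    exact hnd'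

theorem finrank_sector_inf_flatSpace_le
    (hB : ∀ x, ∃ ψ : τ → ℝ, Pi.single x (1 : ℝ) =
      ∑ i, f i x • Pi.single (z i) (1 : ℝ) + ∑ T, ψ T • B T)
    (hconn : ∀ r : Fin M → Fin M → Prop, Equivalence r →
      (∀ i j x, f i x * f j x ≠ 0 → r i j) → ∀ i j, r i j) :
    Module.finrank ℂ ↥(sector Λ M ⊓ flatSpace B) ≤ M + 1 := by
  let F : ↥(sector Λ M ⊓ flatSpace B) →ₗ[ℂ] (Fin (M + 1) → ℂ) :=
    { toFun := fun Φ k =>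
        spinAmplitude z (fun i : Fin M => if i.val < k then (0 : Fin 2) else 1) Φ ∅
      map_add' := fun Φ Ψ => by ext k; simp
      map_smul' := fun a Φ => by ext k; simp }
  have hF : Function.Injective F := by
    rw [injective_iff_map_eq_zero]
    rintro ⟨Φ, hN, h⟩ h0
    rw [Subtype.ext_iff]
    refine eq_zero_of_spinAmplitude hB hN h fun σ => ?_
    obtain ⟨k, π, hσ⟩ := exists_perm_comp_eq σ
    rw [hσ, spinAmplitude_comp_perm hB hconn π h]
    exact eq_zero_of_mem_sector_zero (spinAmplitude_mem_sector hN _) (congrFun h0 k)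
  simpa using LinearMap.finrank_le_finrank_of_injective hF

end Amplitudes

end Hubbard

/-- A space of functions of dimension `M` has a basis that is dual to the evaluations at `M`
points. -/
theorem Submodule.exists_basis_dual_to_points {K Λ : Type*} [Field K] [Fintype Λ] {M : ℕ}
    (V : Submodule K (Λ → K)) (hV : Module.finrank K V = M) :
    ∃ (f : Fin M → Λ → K) (z : Fin M → Λ), (∀ i, f i ∈ V) ∧
      (∀ i j, f i (z j) = if i = j then 1 else 0) ∧ ∀ v ∈ V, v = ∑ i, v (z i) • f i := by
  classical
  let e : Λ → Module.Dual K V := fun x => LinearMap.proj x ∘ₗ V.subtype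
  -- Evaluations separate the elements of `V`, so an independent subfamily with the same span is a
  -- basis of the dual; `f` is the basis of `V` dual to it.
  obtain ⟨κ, a, ha, hspan, hli⟩ := exists_linearIndependent' K e
  have : Finite κ := Finite.of_injective a ha
  have : Fintype κ := Fintype.ofFinite κ
  have hzero : ∀ v : V, (∀ k, v.1 (a k) = 0) → v = 0 := by
    intro v hv
    ext x
    have hx : e x ∈ Submodule.span K (Set.range (e ∘ a)) := by
      rw [hspan]; exact Submodule.subset_span ⟨x, rfl⟩
    have hle : Submodule.span K (Set.range (e ∘ a)) ≤ LinearMap.ker (Module.Dual.eval K V v) := by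
      rw [Submodule.span_le]
      rintro _ ⟨k, rfl⟩
      exact hv k
    exact hle hx
  let F : V →ₗ[K] (κ → K) := LinearMap.pi fun k => e (a k)
  have hF : Function.Injective F := by
    rw [injective_iff_map_eq_zero]
    exact fun v hv => hzero v fun k => congrFun hv k
  have hcard : Fintype.card κ = M := by
    apply le_antisymm
    · have := hli.fintype_card_le_finrank
      rwa [Subspace.dual_finrank_eq, hV] at this
    · have := LinearMap.finrank_le_finrank_of_injective hF
      rwa [hV, Module.finrank_fintype_fun_eq_card] at this
  let G : V ≃ₗ[K] (κ → K) := LinearEquiv.ofInjectiveOfFinrankEq F hF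
    (by rw [hV, Module.finrank_fintype_fun_eq_card, hcard])
  have hG : ∀ (v : V) k, G v k = v.1 (a k) := fun v k => rfl
  let ε : Fin M ≃ κ := (Fintype.equivFinOfCardEq hcard).symm
  have hdual : ∀ i j, (G.symm (Pi.single (ε i) 1)).1 (a (ε j)) = if i = j then 1 else 0 := by
    intro i j
    rw [← hG, LinearEquiv.apply_symm_apply, Pi.single_apply]
    simp [eq_comm]
  refine ⟨fun i => (G.symm (Pi.single (ε i) 1)).1, fun i => a (ε i), fun i => Subtype.prop _,
    hdual, fun v hv => ?_⟩
  have h0 := hzero (⟨v, hv⟩ - ∑ i, v (a (ε i)) • G.symm (Pi.single (ε i) 1)) ?_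
  · have := congrArg Subtype.val (sub_eq_zero.mp h0)
    simpa using this
  · intro k
    obtain ⟨j, rfl⟩ := ε.surjective k
    simp only [Submodule.coe_sub, Submodule.coe_sum, Submodule.coe_smul, Pi.sub_apply,
      Finset.sum_apply, Pi.smul_apply, hdual]
    simp

namespace Hubbard

/-! ### From one-electron kernels to ferromagnetism. -/

section FlatBand

variable {Λ τ : Type*} [Fintype Λ] [Fintype τ] [DecidableEq Λ]

/-- The functional `v ↦ v x - ∑ f i x * v (z i)` vanishes on `ker B`, and the annihilator of the
kernel is the row space. -/
theorem exists_single_eq_sum_add_sum_rows {B : Matrix τ Λ ℝ} {M : ℕ} {f : Fin M → Λ → ℝ}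
    {z : Fin M → Λ} (hf : ∀ v, B.mulVec v = 0 → v = ∑ i, v (z i) • f i) (x : Λ) :
    ∃ ψ : τ → ℝ, Pi.single x (1 : ℝ) =
      ∑ i, f i x • Pi.single (z i) (1 : ℝ) + ∑ T, ψ T • B T := by
  classical
  let φ : Module.Dual ℝ (Λ → ℝ) :=
    LinearMap.proj x - ∑ i, f i x • (LinearMap.proj (z i) : (Λ → ℝ) →ₗ[ℝ] ℝ)
  have hφ : φ ∈ (LinearMap.ker B.mulVecLin).dualAnnihilator := by
    rw [Submodule.mem_dualAnnihilator]
    intro v hv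
    have h := congrFun (hf v hv) x
    simp only [Finset.sum_apply, Pi.smul_apply, smul_eq_mul] at h
    simp only [φ, LinearMap.sub_apply, LinearMap.sum_apply, LinearMap.smul_apply,
      LinearMap.proj_apply, smul_eq_mul]
    rw [h, sub_eq_zero]
    exact Finset.sum_congr rfl fun i _ => mul_comm _ _
  rw [← LinearMap.range_dualMap_eq_dualAnnihilator_ker] at hφ
  obtain ⟨η, hη⟩ := hφ
  refine ⟨fun T => η (Pi.single T 1), ?_⟩
  rw [← sub_eq_iff_eq_add']
  funext y
  have h := congrArg (fun g : Module.Dual ℝ (Λ → ℝ) => g (Pi.single y 1)) hη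
  simp only [LinearMap.dualMap_apply, Matrix.mulVecLin_apply, φ, LinearMap.sub_apply,
    LinearMap.sum_apply, LinearMap.smul_apply, LinearMap.proj_apply] at h
  rw [LinearMap.pi_apply_eq_sum_univ η] at h
  simp only [Matrix.mulVec_single_one, Matrix.col_apply, smul_eq_mul] at h
  simp only [Pi.sub_apply, Finset.sum_apply, Pi.smul_apply, smul_eq_mul]
  rw [Finset.sum_congr rfl fun T _ => mul_comm (η (Pi.single T 1)) (B T y)]
  have hs : ∀ a b : Λ,
      (Pi.single a (1 : ℝ) : Λ → ℝ) b = (Pi.single b (1 : ℝ) : Λ → ℝ) a := fun a b => by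
    simp [Pi.single_apply, eq_comm]
  have hη' : ∀ T : τ, (fun T' => if T = T' then (1 : ℝ) else 0) = Pi.single T 1 := fun T => by
    funext T'
    simp [Pi.single_apply, eq_comm]
  simp only [hη'] at h
  rw [h, hs x y]
  exact congrArg _ (Finset.sum_congr rfl fun i _ => by rw [hs])

omit [Fintype τ] [DecidableEq Λ] in
/-- If only constant functions multiply the kernel of `B` into itself, then the supports of the
elements of a dual basis of the kernel are connected. -/
theorem rel_of_mul_mem_ker {B : Matrix τ Λ ℝ} {M : ℕ} {f : Fin M → Λ → ℝ} {z : Fin M → Λ}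
    (hker : ∀ i, B.mulVec (f i) = 0) (hfz : ∀ i j, f i (z j) = if i = j then 1 else 0)
    (hf : ∀ v, B.mulVec v = 0 → v = ∑ i, v (z i) • f i)
    (hB : ∀ χ : Λ → ℝ, (∀ v, B.mulVec v = 0 → B.mulVec (χ * v) = 0) → ∀ x y, χ x = χ y)
    (r : Fin M → Fin M → Prop) (hr : Equivalence r) (hrf : ∀ i j x, f i x * f j x ≠ 0 → r i j)
    (i₀ j₀ : Fin M) : r i₀ j₀ := by
  classical
  -- The indicator of the union of the supports in the class of `i₀`. Other classes have supports
  -- disjoint from it, so multiplication by `χ` keeps the coefficients of this class and deletes the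
  -- rest.
  let χ : Λ → ℝ := fun x => if ∃ i, r i₀ i ∧ f i x ≠ 0 then 1 else 0
  have hχ : ∀ v, B.mulVec v = 0 → B.mulVec (χ * v) = 0 := by
    intro v hv
    have e : χ * v = ∑ i, (if r i₀ i then v (z i) else 0) • f i := by
      funext x
      rw [Pi.mul_apply]
      conv_lhs => rw [hf v hv]
      simp only [Finset.sum_apply, Pi.smul_apply, smul_eq_mul, Finset.mul_sum]
      refine Finset.sum_congr rfl fun j _ => ?_
      by_cases hj : f j x = 0
      · simp [hj]
      · have : (∃ i, r i₀ i ∧ f i x ≠ 0) ↔ r i₀ j :=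
          ⟨fun ⟨i, hi, hi'⟩ => hr.trans hi (hrf i j x (mul_ne_zero hi' hj)), fun h => ⟨j, h, hj⟩⟩
        simp only [χ, this]
        split_ifs <;> simp
    rw [e, Matrix.mulVec_sum]
    exact Finset.sum_eq_zero fun i _ => by rw [Matrix.mulVec_smul, hker, smul_zero]
  have h := hB χ hχ (z i₀) (z j₀)
  have h1 : χ (z i₀) = 1 := if_pos ⟨i₀, hr.refl _, by simp [hfz]⟩
  rw [h1] at h
  by_contra hne
  refine one_ne_zero (h.trans (if_neg ?_))
  rintro ⟨i, hi, hi'⟩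
  rw [hfz] at hi'
  obtain rfl : i = j₀ := by by_contra hij; simp [hij] at hi'
  exact hne hi

/-- Flat-band ferromagnetism: if the one-electron ground states form the kernel of `B`, and only
constant functions multiply this kernel into itself, then the ground states of the Hubbard model
with as many electrons as one-electron ground states form a single multiplet of maximal spin. -/
theorem flatBand_ferromagnetism (B : Matrix τ Λ ℝ) {M : ℕ}
    (hM : Module.finrank ℝ (LinearMap.ker B.mulVecLin) = M)
    (hB : ∀ χ : Λ → ℝ, (∀ v, B.mulVec v = 0 → B.mulVec (χ * v) = 0) → ∀ x y, χ x = χ y)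
    {t U : ℝ} (ht : 0 < t) (hU : 0 < U) {H : State Λ →ₗ[ℂ] State Λ}
    (hH : H = hamiltonian (t • (B.transpose * B) - (2 * t) • (1 : Matrix Λ Λ ℝ)) fun _ => U) :
    IsGroundEnergy H M (-2 * t * M) ∧
      (∀ Φ ∈ energySpace H M (-2 * t * M),
        totalSpinSq Λ Φ = (((M : ℂ) / 2) * ((M : ℂ) / 2 + 1)) • Φ) ∧
      Module.finrank ℂ (energySpace H M (-2 * t * M)) = M + 1 ∧
      ∀ k ∈ Finset.range (M + 1),
        Module.finrank ℂ ↥(energySpace H M (-2 * t * M) ⊓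
          Module.End.eigenspace (totalSpin Λ 2) ((M : ℂ) / 2 - k)) = 1 := by
  obtain ⟨f, z, hfV, hfz, hf⟩ := Submodule.exists_basis_dual_to_points _ hM
  have hker : ∀ i, B.mulVec (f i) = 0 := hfV
  have hE : energySpace H M (-2 * t * M) = sector Λ M ⊓ flatSpace B := by
    rw [hH]; exact energySpace_eq B ht hU M
  have hdim : Module.finrank ℂ (energySpace H M (-2 * t * M)) ≤ M + 1 := by
    rw [hE]
    exact finrank_sector_inf_flatSpace_le (exists_single_eq_sum_add_sum_rows hf)
      fun r hr hrf i j => rel_of_mul_mem_ker hker hfz hf hB r hr hrf i j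
  set L := (List.finRange M).map f with hL
  have hlen : L.length = M := by simp [hL]
  have hne : upState L ≠ 0 := upState_map_ne_zero hfz (List.nodup_finRange M)
  have hmem : upState L ∈ sector Λ M ⊓ flatSpace B := by
    refine ⟨?_, upState_mem_flatSpace fun g hg T => ?_⟩
    · have := upState_mem_sector L
      rwa [hlen] at this
    · obtain ⟨i, -, rfl⟩ := List.mem_map.mp hg
      exact congrFun (hker i) T
  obtain ⟨hspan, hfin, huniq⟩ := Module.End.span_eq_of_finrank_le (totalSpin Λ 2)
    (energySpace H M (-2 * t * M)) hdim
    (fun k : Fin (M + 1) => (spinLower Λ ^ (k : ℕ)) (upState L))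
    (fun k : Fin (M + 1) => (M : ℂ) / 2 - (k : ℕ))
    (fun k l h => by simpa [Fin.ext_iff] using h)
    (fun k => by rw [hE]; exact spinLower_pow_mem hmem k)
    (fun k => spinLower_pow_upState_ne_zero hne (by rw [hlen]; omega))
    (fun k => by have := (spinLower_pow_upState L k).1; rwa [hlen] at this)
  refine ⟨⟨?_, ?_⟩, ?_, hfin, ?_⟩
  · rw [Set.mem_ofPred_eq, hE, Submodule.ne_bot_iff]
    exact ⟨_, hmem, hne⟩
  · intro E hE'
    rw [Set.mem_ofPred_eq, hH] at hE'
    exact le_of_energySpace_ne_bot B ht hU M hE'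
  · intro Φ hΦ
    rw [← hspan] at hΦ
    have hle : Submodule.span ℂ
        (Set.range fun k : Fin (M + 1) => (spinLower Λ ^ (k : ℕ)) (upState L)) ≤
        Module.End.eigenspace (totalSpinSq Λ) (((M : ℂ) / 2) * ((M : ℂ) / 2 + 1)) := by
      rw [Submodule.span_le]
      rintro _ ⟨k, rfl⟩
      rw [SetLike.mem_coe, Module.End.mem_eigenspace_iff]
      have := totalSpinSq_spinLower_pow_upState L k
      rwa [hlen] at this
    exact Module.End.mem_eigenspace_iff.mp (hle hΦ)
  · intro k hk
    exact huniq ⟨k, Finset.mem_range.mp hk⟩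

theorem eigenspace_gram_sub (B : Matrix τ Λ ℝ) {t : ℝ} (ht : t ≠ 0) :
    Module.End.eigenspace
      (Matrix.mulVecLin (t • (B.transpose * B) - (2 * t) • (1 : Matrix Λ Λ ℝ))) (-2 * t) =
      LinearMap.ker B.mulVecLin := by
  rw [← Matrix.ker_mulVecLin_transpose_mul_self]
  ext v
  rw [Module.End.mem_eigenspace_iff, LinearMap.mem_ker, Matrix.mulVecLin_apply,
    Matrix.mulVecLin_apply, Matrix.sub_mulVec, Matrix.smul_mulVec, Matrix.smul_mulVec,
    Matrix.one_mulVec, sub_eq_iff_eq_add, neg_mul, neg_smul, neg_add_cancel, smul_eq_zero,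
    or_iff_right ht]

theorem le_of_hasEigenvalue_gram_sub (B : Matrix τ Λ ℝ) {t ε : ℝ} (ht : 0 < t)
    (h : Module.End.HasEigenvalue
      (Matrix.mulVecLin (t • (B.transpose * B) - (2 * t) • (1 : Matrix Λ Λ ℝ))) ε) :
    -2 * t ≤ ε := by
  obtain ⟨v, hv, hv0⟩ := h.exists_hasEigenvector
  rw [Module.End.mem_eigenspace_iff, Matrix.mulVecLin_apply, Matrix.sub_mulVec,
    Matrix.smul_mulVec, Matrix.smul_mulVec, Matrix.one_mulVec, ← Matrix.mulVec_mulVec] at hv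
  have e := congrArg (fun w => v ⬝ᵥ w) hv
  simp only [dotProduct_sub, dotProduct_smul, smul_eq_mul] at e
  rw [Matrix.dotProduct_mulVec, Matrix.vecMul_transpose] at e
  have h1 : 0 ≤ B.mulVec v ⬝ᵥ B.mulVec v := Finset.sum_nonneg fun i _ => mul_self_nonneg _
  have h2 : 0 < v ⬝ᵥ v :=
    lt_of_le_of_ne (Finset.sum_nonneg fun i _ => mul_self_nonneg _)
      fun h => hv0 (dotProduct_self_eq_zero.mp h.symm)
  have h3 := mul_nonneg ht.le h1
  exact le_of_mul_le_mul_right (by linarith) h2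

end FlatBand

/-! ### The kagome lattice: incidence matrix, kernel and hexagon states. -/

section Kagome

variable {Γ : AddSubgroup (ℤ × ℤ)}

open scoped Classical in
/-- The incidence matrix between the upward and downward triangles and the sites. -/
noncomputable def kagomeIncidence (Γ : AddSubgroup (ℤ × ℤ)) :
    Matrix (((ℤ × ℤ) ⧸ Γ) ⊕ ((ℤ × ℤ) ⧸ Γ)) (KagomeSite Γ) ℝ :=
  Matrix.of fun T x => Sum.elim (fun c => if upTriangle x = c then 1 else 0)
    (fun d => if downTriangle x = d then 1 else 0) T

theorem eq_of_upTriangle_eq_of_downTriangle_eq (h₁ : ((1, 0) : ℤ × ℤ) ∉ Γ)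
    (h₂ : ((0, 1) : ℤ × ℤ) ∉ Γ) (h₃ : ((1, -1) : ℤ × ℤ) ∉ Γ) {x y : KagomeSite Γ}
    (hu : upTriangle x = upTriangle y) (hd : downTriangle x = downTriangle y) : x = y := by
  obtain ⟨c, k⟩ := x
  obtain ⟨c', l⟩ := y
  obtain rfl : c = c' := hu
  have h : (QuotientAddGroup.mk (kagomeShift k) : (ℤ × ℤ) ⧸ Γ) =
      QuotientAddGroup.mk (kagomeShift l) := add_left_cancel hd
  have hkl := QuotientAddGroup.eq.mp h
  -- Both signs of the difference of shifts are needed: the hypotheses exclude one vector of each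
  -- pair `±(1,0)`, `±(0,1)`, `±(1,-1)`.
  have hlk := QuotientAddGroup.eq.mp h.symm
  fin_cases k <;> fin_cases l <;> simp_all [kagomeShift]

variable [Γ.FiniteIndex]

theorem kagomeHopping_eq (h₁ : ((1, 0) : ℤ × ℤ) ∉ Γ) (h₂ : ((0, 1) : ℤ × ℤ) ∉ Γ)
    (h₃ : ((1, -1) : ℤ × ℤ) ∉ Γ) (t : ℝ) [DecidableEq (KagomeSite Γ)] :
    kagomeHopping Γ t = t • ((kagomeIncidence Γ).transpose * kagomeIncidence Γ)
      - (2 * t) • (1 : Matrix (KagomeSite Γ) (KagomeSite Γ) ℝ) := by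
  classical
  ext x y
  have e : ((kagomeIncidence Γ).transpose * kagomeIncidence Γ) x y =
      (if upTriangle x = upTriangle y then 1 else 0)
        + if downTriangle x = downTriangle y then 1 else 0 := by
    simp [Matrix.mul_apply, kagomeIncidence, Fintype.sum_sum_type, eq_comm]
  rw [Matrix.sub_apply, Matrix.smul_apply, Matrix.smul_apply, e, Matrix.one_apply]
  simp only [kagomeHopping, kagomeGraph, smul_eq_mul]
  by_cases hxy : x = y
  · subst hxy; simp; ring
  · by_cases hu : upTriangle x = upTriangle y
    · have hd : downTriangle x ≠ downTriangle y := fun hd =>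
        hxy (eq_of_upTriangle_eq_of_downTriangle_eq h₁ h₂ h₃ hu hd)
      simp [hxy, hu, hd]
    · by_cases hd : downTriangle x = downTriangle y <;> simp [hxy, hu, hd]

theorem _root_.Fintype.sum_boole_mul_eq {α R : Type*} [Fintype α] [NonAssocSemiring R]
    (p : α → Prop) [DecidablePred p] (v : α → R) (a : α) (h : ∀ x, p x ↔ x = a) :
    ∑ x, (if p x then 1 else 0) * v x = v a := by
  rw [Finset.sum_eq_single a (fun b _ hb => by rw [if_neg (mt (h b).mp hb), zero_mul])
    (by simp), if_pos ((h a).mpr rfl), one_mul]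

theorem mulVec_kagomeIncidence_inl (v : KagomeSite Γ → ℝ) (c : (ℤ × ℤ) ⧸ Γ) :
    (kagomeIncidence Γ).mulVec v (Sum.inl c) = v (c, 0) + v (c, 1) + v (c, 2) := by
  classical
  simp only [Matrix.mulVec, dotProduct, kagomeIncidence, Matrix.of_apply, Sum.elim_inl,
    Fintype.sum_prod_type_right, Fin.sum_univ_three]
  congr 2
  all_goals exact Fintype.sum_boole_mul_eq _ _ _ fun x => Iff.rfl

theorem mulVec_kagomeIncidence_inr (v : KagomeSite Γ → ℝ) (d : (ℤ × ℤ) ⧸ Γ) :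
    (kagomeIncidence Γ).mulVec v (Sum.inr d) =
      v (d, 0) + v (d - QuotientAddGroup.mk (1, 0), 1)
        + v (d - QuotientAddGroup.mk (0, 1), 2) := by
  classical
  simp only [Matrix.mulVec, dotProduct, kagomeIncidence, Matrix.of_apply, Sum.elim_inr,
    Fintype.sum_prod_type_right, Fin.sum_univ_three]
  congr 2
  · refine Fintype.sum_boole_mul_eq _ _ _ fun x => ?_
    exact (eq_sub_iff_add_eq (c := (0 : (ℤ × ℤ) ⧸ Γ))).symm.trans (by rw [sub_zero])
  all_goals exact Fintype.sum_boole_mul_eq _ _ _ fun x => eq_sub_iff_add_eq.symm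

omit [Γ.FiniteIndex] in
theorem eq_of_periodic {α : Type*} {P : (ℤ × ℤ) ⧸ Γ → α}
    (h1 : Function.Periodic P (QuotientAddGroup.mk (1, 0)))
    (h2 : Function.Periodic P (QuotientAddGroup.mk (0, 1))) (c d : (ℤ × ℤ) ⧸ Γ) :
    P c = P d := by
  have key : ∀ c, P c = P 0 := by
    intro c
    induction c using QuotientAddGroup.induction_on with
    | H g =>
      have e : (QuotientAddGroup.mk g : (ℤ × ℤ) ⧸ Γ) =
          0 + g.1 • QuotientAddGroup.mk (1, 0) + g.2 • QuotientAddGroup.mk (0, 1) := by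
        rw [zero_add, ← QuotientAddGroup.mk_zsmul, ← QuotientAddGroup.mk_zsmul,
          ← QuotientAddGroup.mk_add]
        congr 1
        ext <;> simp
      rw [e, h2.zsmul, h1.zsmul]
  rw [key c, key d]

/-- An element of `ker Bᵀ` takes opposite values on triangles sharing a site, so it is periodic
under both translations and fixed by one value. Equality of row and column rank then gives the
dimension of `ker B`. -/
theorem finrank_ker_kagomeIncidence :
    Module.finrank ℝ (LinearMap.ker (kagomeIncidence Γ).mulVecLin) =
      Fintype.card ((ℤ × ℤ) ⧸ Γ) + 1 := by
  classical
  have h1 : Module.finrank ℝ (LinearMap.ker (kagomeIncidence Γ).transpose.mulVecLin) = 1 := by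
    rw [finrank_eq_one_iff']
    have hker : ∀ w, w ∈ LinearMap.ker (kagomeIncidence Γ).transpose.mulVecLin ↔
        ∀ c k, w (Sum.inl c) + w (Sum.inr (c + QuotientAddGroup.mk (kagomeShift k))) = 0 := by
      intro w
      rw [LinearMap.mem_ker, Matrix.mulVecLin_apply, funext_iff, Prod.forall]
      refine forall_congr' fun c => forall_congr' fun k => ?_
      simp only [Matrix.mulVec, dotProduct, Fintype.sum_sum_type]
      refine Eq.congr (congr_arg₂ _ ?_ ?_) rfl
      · exact Fintype.sum_boole_mul_eq _ (fun c => w (Sum.inl c)) _ fun x => eq_comm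
      · exact Fintype.sum_boole_mul_eq _ (fun d => w (Sum.inr d)) _ fun x => eq_comm
    refine ⟨⟨Sum.elim (fun _ => 1) (fun _ => -1), (hker _).mpr (by simp)⟩, ?_, ?_⟩
    · intro h
      have := congrFun (congrArg Subtype.val h) (Sum.inl 0)
      simp at this
    · rintro ⟨w, hw⟩
      rw [hker] at hw
      have h0 : ∀ c, w (Sum.inl c) + w (Sum.inr c) = 0 := fun c => by
        simpa [kagomeShift, show (QuotientAddGroup.mk (0, 0) : (ℤ × ℤ) ⧸ Γ) = 0 from rfl]
          using hw c 0
      have h1 : ∀ c, w (Sum.inl c) + w (Sum.inr (c + QuotientAddGroup.mk (1, 0))) = 0 :=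
        fun c => hw c 1
      have h2 : ∀ c, w (Sum.inl c) + w (Sum.inr (c + QuotientAddGroup.mk (0, 1))) = 0 :=
        fun c => hw c 2
      have hconst := eq_of_periodic (P := fun c => w (Sum.inr c))
        (fun c => by linarith [h0 c, h1 c]) (fun c => by linarith [h0 c, h2 c])
      refine ⟨-w (Sum.inr 0), Subtype.ext ?_⟩
      funext T
      rcases T with c | d
      · simp only [Submodule.coe_smul, Pi.smul_apply, Sum.elim_inl, smul_eq_mul]
        linarith [h0 c, hconst c 0]
      · simp only [Submodule.coe_smul, Pi.smul_apply, Sum.elim_inr, smul_eq_mul]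
        linarith [hconst d 0]
  have h2 := LinearMap.finrank_range_add_finrank_ker (kagomeIncidence Γ).transpose.mulVecLin
  have h3 := LinearMap.finrank_range_add_finrank_ker (kagomeIncidence Γ).mulVecLin
  have h4 := Matrix.rank_transpose (kagomeIncidence Γ)
  rw [Matrix.rank, Matrix.rank] at h4
  rw [h1, h4, Module.finrank_fintype_fun_eq_card, Fintype.card_sum] at h2
  rw [Module.finrank_fintype_fun_eq_card, Fintype.card_prod, Fintype.card_fin] at h3
  omega

open scoped Classical in
/-- The alternating state on the six sites of a hexagon. -/
noncomputable def hexagonState (u : (ℤ × ℤ) ⧸ Γ) : KagomeSite Γ → ℝ := fun x =>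
  let p : (ℤ × ℤ) ⧸ Γ → ℝ := fun c => if x.1 = c then 1 else 0
  let a : (ℤ × ℤ) ⧸ Γ := QuotientAddGroup.mk (1, 0)
  let b : (ℤ × ℤ) ⧸ Γ := QuotientAddGroup.mk (0, 1)
  ![p u - p (u - a + b), p (u - a + b) - p (u - a), p (u - a) - p u] x.2

/-- In each triangle the three differences telescope, even if some of the cells coincide modulo `Γ`.
-/
theorem mulVec_hexagonState (u : (ℤ × ℤ) ⧸ Γ) :
    (kagomeIncidence Γ).mulVec (hexagonState u) = 0 := by
  classical
  funext T
  rcases T with c | d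
  · rw [mulVec_kagomeIncidence_inl]
    simp [hexagonState]
  · rw [mulVec_kagomeIncidence_inr]
    simp only [hexagonState]
    generalize (QuotientAddGroup.mk (1, 0) : (ℤ × ℤ) ⧸ Γ) = a
    generalize (QuotientAddGroup.mk (0, 1) : (ℤ × ℤ) ⧸ Γ) = b
    have e1 : d - a = u - a + b ↔ d = u + b := by
      rw [sub_eq_iff_eq_add, show u - a + b + a = u + b by abel]
    have e2 : d - b = u - a ↔ d = u - a + b := sub_eq_iff_eq_add
    have e3 : d - b = u ↔ d = u + b := sub_eq_iff_eq_add
    have e4 : d - a = u - a ↔ d = u := sub_left_inj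
    simp [e1, e2, e3, e4]

theorem eq_of_mul_mem_ker_kagomeIncidence (h₁ : ((1, 0) : ℤ × ℤ) ∉ Γ)
    (h₂ : ((0, 1) : ℤ × ℤ) ∉ Γ) (h₃ : ((1, -1) : ℤ × ℤ) ∉ Γ) (χ : KagomeSite Γ → ℝ)
    (hχ : ∀ v, (kagomeIncidence Γ).mulVec v = 0 → (kagomeIncidence Γ).mulVec (χ * v) = 0)
    (x y : KagomeSite Γ) : χ x = χ y := by
  classical
  have key := fun u => hχ _ (mulVec_hexagonState u)
  have up := fun u c => congrFun (key u) (Sum.inl c)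
  have down := fun u d => congrFun (key u) (Sum.inr d)
  simp only [mulVec_kagomeIncidence_inl, mulVec_kagomeIncidence_inr, Pi.mul_apply,
    hexagonState, Pi.zero_apply] at up down
  have ha : (QuotientAddGroup.mk (1, 0) : (ℤ × ℤ) ⧸ Γ) ≠ 0 := fun h =>
    h₁ ((QuotientAddGroup.eq_zero_iff _).mp h)
  have hb : (QuotientAddGroup.mk (0, 1) : (ℤ × ℤ) ⧸ Γ) ≠ 0 := fun h =>
    h₂ ((QuotientAddGroup.eq_zero_iff _).mp h)
  have hab : (QuotientAddGroup.mk (1, 0) : (ℤ × ℤ) ⧸ Γ) - QuotientAddGroup.mk (0, 1) ≠ 0 :=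
    fun h => h₃ ((QuotientAddGroup.eq_zero_iff _).mp h)
  have hconst := fun P : (ℤ × ℤ) ⧸ Γ → ℝ => eq_of_periodic (P := P)
  generalize (QuotientAddGroup.mk (1, 0) : (ℤ × ℤ) ⧸ Γ) = a at *
  generalize (QuotientAddGroup.mk (0, 1) : (ℤ × ℤ) ⧸ Γ) = b at *
  have d1 : ∀ u : (ℤ × ℤ) ⧸ Γ, u ≠ u - a := fun u h =>
    ha (sub_eq_self.mp h.symm)
  have d2 : ∀ u : (ℤ × ℤ) ⧸ Γ, u ≠ u - a + b := fun u h => hab (by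
    rw [sub_add, eq_comm, sub_eq_self] at h; exact h)
  have d3 : ∀ u : (ℤ × ℤ) ⧸ Γ, u - a ≠ u - a + b := fun u h => hb (by simpa using h)
  -- Each triangle used here and below meets the chosen hexagon in two sites with opposite signs, so
  -- `χ` agrees there. The facts `d1`, `d2`, `d3` ensure that the periods do not merge the three
  -- cells of the hexagon.
  have h02 : ∀ u, χ (u, 0) = χ (u, 2) := fun u => by
    have := up u u
    simp [d1, d2] at this
    linarith
  have h12 : ∀ u, χ (u, 1) = χ (u, 2) := fun u => by
    have := up (u + a) u
    have e := d1 (u + a)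
    have e' := d3 (u + a)
    rw [add_sub_cancel_right] at e e'
    simp [e.symm, e'] at this
    linarith
  have h01 : ∀ u, χ (u, 0) = χ (u - a, 1) := fun u => by
    have := down u u
    simp [d1, d2, hb, (sub_ne_zero.mp hab).symm] at this
    linarith
  have hP1 : ∀ u, χ (u + a, 0) = χ (u, 0) := fun u => by
    rw [h01 (u + a), add_sub_cancel_right, h12, h02]
  have hP2 : ∀ u, χ (u + b, 0) = χ (u, 0) := fun u => by
    have := down u (u + b)
    simp [d1, d2, hb, add_sub_right_comm] at this
    have e := hP1 (u - a + b)
    rw [show u - a + b + a = u + b by abel, h02 (u - a + b), ← h12 (u - a + b)] at e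
    rw [e, h02 u]
    linarith
  have h0 := hconst (fun c => χ (c, 0)) hP1 hP2
  have hall : ∀ (c : (ℤ × ℤ) ⧸ Γ) (k : Fin 3), χ (c, k) = χ (c, 0) := by
    intro c k
    fin_cases k
    · rfl
    · exact (h12 c).trans (h02 c).symm
    · exact (h02 c).symm
  obtain ⟨c, k⟩ := x
  obtain ⟨d, l⟩ := y
  rw [hall, hall d, h0 c d]

end Kagome

end Hubbard

/-! ### The theorem for the kagome lattice. -/

theorem mainTheorem3 (Γ : AddSubgroup (ℤ × ℤ)) [Γ.FiniteIndex]
    (h₁ : ((1, 0) : ℤ × ℤ) ∉ Γ) (h₂ : ((0, 1) : ℤ × ℤ) ∉ Γ) (h₃ : ((1, -1) : ℤ × ℤ) ∉ Γ)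
    (t : ℝ) (ht : 0 < t) (M : ℕ) (hM : M = Fintype.card (Hubbard.KagomeSite Γ) / 3 + 1) :
    -- the lowest one-electron level is `-2t`, and its degeneracy is `M = |Λ| / 3 + 1`
    (3 ∣ Fintype.card (Hubbard.KagomeSite Γ) ∧
      IsLeast {ε : ℝ | Module.End.HasEigenvalue
        (Matrix.mulVecLin (Hubbard.kagomeHopping Γ t)) ε} (-2 * t) ∧
      Module.finrank ℝ (Module.End.eigenspace
        (Matrix.mulVecLin (Hubbard.kagomeHopping Γ t)) (-2 * t)) = M) ∧
    -- the maximal total spin of `M` electrons is `M / 2`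
    Hubbard.maxSpin (Fintype.card (Hubbard.KagomeSite Γ)) M = (M : ℝ) / 2 ∧
    ∀ U : ℝ, 0 < U → ∃ E₀ : ℝ,
      Hubbard.IsGroundEnergy
        (Hubbard.hamiltonian (Hubbard.kagomeHopping Γ t) fun _ => U) M E₀ ∧
      -- every ground state has the maximal total spin
      (∀ Φ ∈ Hubbard.energySpace
          (Hubbard.hamiltonian (Hubbard.kagomeHopping Γ t) fun _ => U) M E₀,
        Hubbard.totalSpinSq (Hubbard.KagomeSite Γ) Φ =
          (((M : ℂ) / 2) * ((M : ℂ) / 2 + 1)) • Φ) ∧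
      -- the ground states form a single spin multiplet: their space has dimension `2 S_max + 1`
      Module.finrank ℂ (Hubbard.energySpace
          (Hubbard.hamiltonian (Hubbard.kagomeHopping Γ t) fun _ => U) M E₀) = M + 1 ∧
      -- and for each of the values `-S_max, ..., S_max` of the third component of the total
      -- spin, the ground state is unique up to a factor
      ∀ k ∈ Finset.range (M + 1),
        Module.finrank ℂ ↥(Hubbard.energySpace
            (Hubbard.hamiltonian (Hubbard.kagomeHopping Γ t) fun _ => U) M E₀ ⊓
          Module.End.eigenspace (Hubbard.totalSpin (Hubbard.KagomeSite Γ) 2)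
            ((M : ℂ) / 2 - k)) = 1 := by
  classical
  have hcard : Fintype.card (Hubbard.KagomeSite Γ) = Fintype.card ((ℤ × ℤ) ⧸ Γ) * 3 := by
    rw [Fintype.card_prod, Fintype.card_fin]
  have hpos : 0 < Fintype.card ((ℤ × ℤ) ⧸ Γ) := Fintype.card_pos
  have hM' : M = Fintype.card ((ℤ × ℤ) ⧸ Γ) + 1 := by omega
  have hker := Hubbard.finrank_ker_kagomeIncidence (Γ := Γ)
  rw [← hM'] at hker
  have hT := Hubbard.kagomeHopping_eq h₁ h₂ h₃ t
  have heig : Module.End.eigenspace (Matrix.mulVecLin (Hubbard.kagomeHopping Γ t)) (-2 * t) =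
      LinearMap.ker (Hubbard.kagomeIncidence Γ).mulVecLin := by
    rw [hT]; exact Hubbard.eigenspace_gram_sub _ ht.ne'
  refine ⟨⟨⟨_, hcard.trans (mul_comm _ _)⟩, ⟨?_, fun ε hε => ?_⟩, by rw [heig, hker]⟩, ?_,
    fun U hU => ⟨-2 * t * M, ?_⟩⟩
  · rw [Set.mem_ofPred_eq, Module.End.hasEigenvalue_iff, heig]
    intro h
    rw [h, finrank_bot] at hker
    omega
  · rw [Set.mem_ofPred_eq, hT] at hε
    exact Hubbard.le_of_hasEigenvalue_gram_sub _ ht hε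
  -- With `n ≥ 1` cells, `M = n + 1 ≤ 3n`, so the filling is in the first case of `maxSpin`.
  · rw [Hubbard.maxSpin, if_pos (by omega)]
  · exact Hubbard.flatBand_ferromagnetism (Hubbard.kagomeIncidence Γ) hker
      (Hubbard.eq_of_mul_mem_ker_kagomeIncidence h₁ h₂ h₃) ht hU (by rw [hT])
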